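/- Let $L$ be a compact connected (Hausdorff) affine manifold of dimension $n$, that is, a manifold with an atlas modelled on $\mathbb R^n$ whose coordinate changes are locally affine, and let $\nabla$ be its flat torsion-free connection. Suppose that the linear holonomy of $L$ is contained in $GL(n,\mathbb Z)$: there are a point $x_0\in L$ and a basis $b$ of $T_{x_0}L$ in which the parallel transport along every loop at $x_0$ has a matrix in $GL(n,\mathbb Z)$. Then $(L,\nabla)$ is a leaf of a lagrangian foliation on a compact symplectic manifold: there are a compact Hausdorff smooth manifold $M$ of dimension $2n$, a symplectic form $\omega$ on $M$, a smooth foliation $\mathcal F$ of $M$ with $T\mathcal F=(T\mathcal F)^{\perp_\omega}$, and an injective immersion $\iota\colon L\to M$, tangent to $\mathcal F$, whose image is a leaf of $\mathcal F$, such that $\nabla$ is the Weinstein connection of this leaf, i.e. the connection determined by $$\omega(\nabla_XY,Z)=X\cdot\omega(Y,Z)-\omega(Y,[X,Z])$$ for vector fields $X,Y$ tangent to $\mathcal F$ and arbitrary $Z$. Moreover, $M$ can be taken to be the torus bundle over $L$ obtained from $T^*L$ by dividing each fibre $T_x^*L$ by the lattice $\Lambda_x\cong\mathbb Z^n$ of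 the covectors that have integral values on the parallel transports of the vectors of $b$ to $x$. More precisely, there is a surjective local diffeomorphism $q\colon T^*L\to M$ with $q(x,\alpha)=q(y,\beta)$ if and only if $x=y$ and $\alpha-\beta\in\Lambda_x$, such that $\iota(x)=q(x,0)$ and such that, in the coordinates $(x,p)$ of $T^*L$ that belong to affine coordinates $x$ of $L$, $q^*\omega=\sum_i dx_i\wedge dp_i$ and $q^*\mathcal F$ is the foliation $dp_1=\dots=dp_n=0$. -/

import Mathlib

open Set Filter Topology Manifold Bundle
open scoped ContDiff

universe u v

noncomputable section

namespace LagrangianLeaf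

/-! ### Affine manifolds -/

section Affine

variable (E : Type v) [NormedAddCommGroup E] [NormedSpace ℝ E]

/-- Maps that are affine near every point of a given set. -/
def affinePregroupoid : Pregroupoid E where
  property f s := ∀ x ∈ s, ∃ A : E →ᴬ[ℝ] E, f =ᶠ[𝓝[s] x] A
  comp {f g u v} hf hg hu hv huv := by
    rintro x ⟨hxu, hxv⟩
    obtain ⟨A, hA⟩ := hf x hxu
    obtain ⟨B, hB⟩ := hg (f x) hxv
    rw [hu.nhdsWithin_eq hxu] at hA
    rw [hv.nhdsWithin_eq hxv] at hB
    have hc : Tendsto f (𝓝 x) (𝓝 (f x)) := by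
      have h1 : Tendsto A (𝓝 x) (𝓝 (A x)) := A.continuous.tendsto x
      rw [← hA.eq_of_nhds] at h1
      exact h1.congr' hA.symm
    refine ⟨B.comp A, Filter.Eventually.filter_mono nhdsWithin_le_nhds ?_⟩
    filter_upwards [hA, hc.eventually hB] with y h1 h2
    rw [Function.comp_apply, h2, h1]
    rfl
  id_mem := fun x _ => ⟨ContinuousAffineMap.id ℝ E, Eventually.of_forall fun _ => rfl⟩
  locality {f u} hu h := by
    intro x hx
    obtain ⟨v, hv, hxv, hf⟩ := h x hx
    obtain ⟨A, hA⟩ := hf x ⟨hx, hxv⟩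
    refine ⟨A, ?_⟩
    rw [(hu.inter hv).nhdsWithin_eq ⟨hx, hxv⟩] at hA
    rwa [hu.nhdsWithin_eq hx]
  congr {f g u} _ h hf := by
    intro x hx
    obtain ⟨A, hA⟩ := hf x hx
    refine ⟨A, ?_⟩
    filter_upwards [hA, self_mem_nhdsWithin] with y h1 h2
    rw [h y h2, h1]

/-- The groupoid of locally affine local homeomorphisms of `E`.  An affine manifold is a manifold
`L` modelled on `E` with `HasGroupoid L (affineGroupoid E)`: its coordinate changes are locally
affine maps. -/
def affineGroupoid : StructureGroupoid E := (affinePregroupoid E).groupoid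

theorem affineGroupoid_le_contDiffGroupoid :
    affineGroupoid E ≤ contDiffGroupoid ∞ 𝓘(ℝ, E) := by
  refine groupoid_of_pregroupoid_le _ _ ?_
  intro f s hf x hx
  have hx' : x ∈ s := hx.1
  obtain ⟨A, hA⟩ := hf x hx'
  have hs : (𝓘(ℝ, E).symm ⁻¹' s ∩ range 𝓘(ℝ, E) : Set E) = s := by simp
  have hA' : f =ᶠ[𝓝[s] x] A := hA
  rw [hs]
  exact (A.contDiff (n := ∞)).contDiffWithinAt.congr_of_eventuallyEq hA'
    (hA'.eq_of_nhdsWithin hx')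

variable {E} {L : Type u} [TopologicalSpace L] [ChartedSpace E L]

instance isManifold_of_affine [h : HasGroupoid L (affineGroupoid E)] :
    IsManifold 𝓘(ℝ, E) ∞ L :=
  { hasGroupoid_of_le h (affineGroupoid_le_contDiffGroupoid E) with }

variable (E)

/-- The flat connection `∇_v η` of an affine manifold, at the point `x`: the derivative of the
coordinate expression of `η` in an affine chart around `x`. -/
def flatConnection (η : ∀ x : L, TangentSpace 𝓘(ℝ, E) x) (x : L) (v : TangentSpace 𝓘(ℝ, E) x) :
    TangentSpace 𝓘(ℝ, E) x :=
  (mvfderiv 𝓘(ℝ, E) (extChartAt 𝓘(ℝ, E) x) x).inverse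
    (mvfderiv 𝓘(ℝ, E) (fun y => mvfderiv 𝓘(ℝ, E) (extChartAt 𝓘(ℝ, E) x) y (η y)) x v)

variable {E}

/-- `w` is the parallel transport of `v` along the path `γ`, for the flat connection of an affine
manifold: there is a vector field along `γ` from `v` to `w` whose coordinates in affine charts are
locally constant. -/
def IsParallelTransport {x y : L} (γ : Path x y) (v : TangentSpace 𝓘(ℝ, E) x)
    (w : TangentSpace 𝓘(ℝ, E) y) : Prop :=
  ∃ V : unitInterval → TangentBundle 𝓘(ℝ, E) L,
    (∀ t, (V t).proj = γ t) ∧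
    (∀ t₀, ∀ᶠ t in 𝓝 t₀,
      mvfderiv 𝓘(ℝ, E) (extChartAt 𝓘(ℝ, E) (V t₀).proj) (V t).proj (V t).snd =
        mvfderiv 𝓘(ℝ, E) (extChartAt 𝓘(ℝ, E) (V t₀).proj) (V t₀).proj (V t₀).snd) ∧
    V 0 = ⟨x, v⟩ ∧ V 1 = ⟨y, w⟩

variable (E) in
/-- The linear holonomy of an affine manifold at `x₀`: all parallel transports along loops. -/
def linearHolonomy (x₀ : L) : Set (TangentSpace 𝓘(ℝ, E) x₀ ≃ₗ[ℝ] TangentSpace 𝓘(ℝ, E) x₀) :=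
  {A | ∃ γ : Path x₀ x₀, ∀ v, IsParallelTransport γ v (A v)}

/-- In the basis `b` of the tangent space at `x₀`, the linear holonomy is contained in
`GL(n, ℤ)`. -/
def HasIntegralLinearHolonomy {n : ℕ} {x₀ : L}
    (b : Module.Basis (Fin n) ℝ (TangentSpace 𝓘(ℝ, E) x₀)) : Prop :=
  ∀ A ∈ linearHolonomy E x₀, ∃ B : GL (Fin n) ℤ,
    LinearMap.toMatrix b b A.toLinearMap = (B : Matrix (Fin n) (Fin n) ℤ).map (Int.cast : ℤ → ℝ)

/-- The lattice in the cotangent space at `x` that consists of the covectors with integral values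
on the parallel transports of `b` to `x`.  At `x₀` it is spanned by the dual basis of `b` if the
holonomy is integral in `b`. -/
def cotangentLattice {n : ℕ} {x₀ : L} (b : Module.Basis (Fin n) ℝ (TangentSpace 𝓘(ℝ, E) x₀))
    (x : L) : Set (TangentSpace 𝓘(ℝ, E) x →L[ℝ] ℝ) :=
  {α | ∀ (γ : Path x₀ x) (i : Fin n) (w : TangentSpace 𝓘(ℝ, E) x),
    IsParallelTransport γ (b i) w → ∃ k : ℤ, α w = k}

variable (E L) in
/-- The cotangent bundle of `L`, with Mathlib's manifold structure: its charts are the natural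
coordinates `(x, p)` that belong to the charts `x` of `L`. -/
abbrev CotangentBundle : Type (max u v) :=
  TotalSpace (E →L[ℝ] ℝ) (fun x : L => TangentSpace 𝓘(ℝ, E) x →L[ℝ] ℝ)

end Affine

/-! ### Differential forms, symplectic manifolds, foliations -/

section Forms

variable {F : Type*} [NormedAddCommGroup F] [NormedSpace ℝ F] {H : Type*} [TopologicalSpace H]
  (I : ModelWithCorners ℝ F H) {M : Type*} [TopologicalSpace M] [ChartedSpace H M]

variable (M) in
/-- (Not necessarily continuous) differential `2`-forms on `M`. -/
abbrev TwoForm := ∀ m : M, TangentSpace I m [⋀^Fin 2]→L[ℝ] ℝ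

/-- The coordinate expression of a `2`-form in the chart at `m₀`. -/
def TwoForm.inChart (σ : TwoForm I M) (m₀ : M) (y : F) : F [⋀^Fin 2]→L[ℝ] ℝ :=
  (σ ((extChartAt I m₀).symm y)).compContinuousLinearMap
    (mfderiv 𝓘(ℝ, F) I (extChartAt I m₀).symm y)

/-- The pull-back of a `2`-form by a map. -/
def TwoForm.pullback {F' : Type*} [NormedAddCommGroup F'] [NormedSpace ℝ F'] {H' : Type*}
    [TopologicalSpace H'] (J : ModelWithCorners ℝ F' H') {N : Type*} [TopologicalSpace N]
    [ChartedSpace H' N] (q : N → M) (σ : TwoForm I M) : TwoForm J N :=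
  fun z => (σ (q z)).compContinuousLinearMap (mfderiv J I q z)

end Forms

section Foliations

variable {F : Type*} [NormedAddCommGroup F] [NormedSpace ℝ F]
  {M : Type*} [TopologicalSpace M] [ChartedSpace F M]

/-- Symplectic forms on manifolds without boundary: smooth, closed, nondegenerate `2`-forms. -/
structure IsSymplectic (σ : TwoForm 𝓘(ℝ, F) M) : Prop where
  smooth : ∀ m₀, ContDiffOn ℝ ∞ (σ.inChart 𝓘(ℝ, F) m₀) (extChartAt 𝓘(ℝ, F) m₀).target
  closed : ∀ m₀, ∀ y ∈ (extChartAt 𝓘(ℝ, F) m₀).target, extDeriv (σ.inChart 𝓘(ℝ, F) m₀) y = 0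
  nondegenerate : ∀ m v, (∀ w, σ m ![v, w] = 0) → v = 0

variable (F M) in
/-- Fields of tangent subspaces. -/
abbrev Distribution := ∀ m : M, Submodule ℝ (TangentSpace 𝓘(ℝ, F) m)

/-- `D` is (the tangent distribution of) a smooth foliation with `k`-dimensional leaves: around
each point there is a smooth chart of `M` that takes `D` to the parallel copies of a fixed
`k`-dimensional subspace. -/
def IsFoliation (k : ℕ) (D : Distribution F M) : Prop :=
  ∀ m₀ : M, ∃ φ ∈ IsManifold.maximalAtlas 𝓘(ℝ, F) ∞ M, m₀ ∈ φ.source ∧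
    ∃ K : Submodule ℝ F, Module.finrank ℝ K = k ∧
      ∀ m ∈ φ.source, ∀ v, v ∈ D m ↔ mvfderiv 𝓘(ℝ, F) φ m v ∈ K

/-- The subspaces of `D` are lagrangian: each is its own symplectic orthogonal. -/
def IsLagrangian (σ : TwoForm 𝓘(ℝ, F) M) (D : Distribution F M) : Prop :=
  ∀ m v, v ∈ D m ↔ ∀ w ∈ D m, σ m ![v, w] = 0

/-- Two points are the end points of a smooth curve tangent to `D`. -/
def TangentJoined (D : Distribution F M) (a c : M) : Prop :=
  ∃ γ : ℝ → M, ContMDiff 𝓘(ℝ, ℝ) 𝓘(ℝ, F) ∞ γ ∧ γ 0 = a ∧ γ 1 = c ∧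
    ∀ t, mfderiv 𝓘(ℝ, ℝ) 𝓘(ℝ, F) γ t (1 : ℝ) ∈ D (γ t)

/-- The leaf through `m`: all points that can be reached from `m` along piecewise smooth curves
tangent to `D`. -/
def leafThrough (D : Distribution F M) (m : M) : Set M :=
  {m' | Relation.ReflTransGen (TangentJoined D) m m'}

variable {E : Type*} [NormedAddCommGroup E] [NormedSpace ℝ E]
  {L : Type*} [TopologicalSpace L] [ChartedSpace E L]

/-- `ι : L → M` identifies the manifold `L` with a leaf of the foliation `D`. -/
structure IsLeaf (D : Distribution F M) (ι : L → M) : Prop where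
  smooth : ContMDiff 𝓘(ℝ, E) 𝓘(ℝ, F) ∞ ι
  injective : Function.Injective ι
  immersion : ∀ x, Function.Injective (mfderiv 𝓘(ℝ, E) 𝓘(ℝ, F) ι x)
  tangent : ∀ x v, v ∈ D (ι x) ↔ ∃ ξ, mfderiv 𝓘(ℝ, E) 𝓘(ℝ, F) ι x ξ = v
  range_eq : ∀ x, range ι = leafThrough D (ι x)

/-- Smooth vector fields on `M`. -/
def IsSmoothField [IsManifold 𝓘(ℝ, F) ∞ M] (X : ∀ m : M, TangentSpace 𝓘(ℝ, F) m) : Prop :=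
  ContMDiff 𝓘(ℝ, F) 𝓘(ℝ, F).tangent ∞ (fun m => (⟨m, X m⟩ : TangentBundle 𝓘(ℝ, F) M))

/-- The flat connection of the affine manifold `L` is the Weinstein connection of the leaf
`ι : L → M` of the lagrangian foliation `D`.  The Weinstein connection is the one that corresponds
by symplectic duality to the dual of the Bott connection `(X, Z) ↦ [X, Z]` on the normal bundle:
`σ(∇_X Y, Z) = X (σ(Y, Z)) - σ(Y, [X, Z])` for `X`, `Y` tangent to `D` and any `Z`. -/
def IsWeinsteinConnection [IsManifold 𝓘(ℝ, F) ∞ M] (σ : TwoForm 𝓘(ℝ, F) M)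
    (D : Distribution F M) (ι : L → M) : Prop :=
  ∀ X Y Z : ∀ m : M, TangentSpace 𝓘(ℝ, F) m,
    IsSmoothField X → IsSmoothField Y → IsSmoothField Z →
    (∀ m, X m ∈ D m) → (∀ m, Y m ∈ D m) →
    ∀ ξ η : ∀ x : L, TangentSpace 𝓘(ℝ, E) x,
      (∀ x, mfderiv 𝓘(ℝ, E) 𝓘(ℝ, F) ι x (ξ x) = X (ι x)) →
      (∀ x, mfderiv 𝓘(ℝ, E) 𝓘(ℝ, F) ι x (η x) = Y (ι x)) →
      ∀ x, σ (ι x) ![mfderiv 𝓘(ℝ, E) 𝓘(ℝ, F) ι x (flatConnection E η x (ξ x)), Z (ι x)] =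
        mvfderiv 𝓘(ℝ, F) (fun m => σ m ![Y m, Z m]) (ι x) (X (ι x)) -
          σ (ι x) ![Y (ι x), VectorField.mlieBracket 𝓘(ℝ, F) X Z (ι x)]

/-- `q : T^*L → M` exhibits `M`, with its `2`-form `σ` and its foliation `D`, as the quotient of
the cotangent bundle of the affine manifold `L`, with the canonical form `∑ dxᵢ ∧ dpᵢ` and the
horizontal foliation `dp₁ = ⋯ = dpₙ = 0`, by fibrewise translations by the lattices `Λ x`; here
`(x, p)` are the natural coordinates that belong to affine charts of `L`. -/
structure IsCotangentQuotient [HasGroupoid L (affineGroupoid E)]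
    (Λ : ∀ x : L, Set (TangentSpace 𝓘(ℝ, E) x →L[ℝ] ℝ))
    (σ : TwoForm 𝓘(ℝ, F) M) (D : Distribution F M) (q : CotangentBundle E L → M) : Prop where
  localDiffeomorph : IsLocalDiffeomorph (𝓘(ℝ, E).prod 𝓘(ℝ, E →L[ℝ] ℝ)) 𝓘(ℝ, F) ∞ q
  surjective : Function.Surjective q
  proj_eq : ∀ z z', q z = q z' → z.proj = z'.proj
  eq_iff : ∀ (x : L) (α β : TangentSpace 𝓘(ℝ, E) x →L[ℝ] ℝ),
    q ⟨x, α⟩ = q ⟨x, β⟩ ↔ α - β ∈ Λ x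
  form : ∀ z, ∀ y ∈ (extChartAt (𝓘(ℝ, E).prod 𝓘(ℝ, E →L[ℝ] ℝ)) z).target,
    ∀ v w : E × (E →L[ℝ] ℝ),
      (σ.pullback 𝓘(ℝ, F) (𝓘(ℝ, E).prod 𝓘(ℝ, E →L[ℝ] ℝ)) q).inChart
        (𝓘(ℝ, E).prod 𝓘(ℝ, E →L[ℝ] ℝ)) z y ![v, w] = w.2 v.1 - v.2 w.1
  horizontal : ∀ z, ∀ z' ∈ (extChartAt (𝓘(ℝ, E).prod 𝓘(ℝ, E →L[ℝ] ℝ)) z).source,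
    ∀ v, mfderiv (𝓘(ℝ, E).prod 𝓘(ℝ, E →L[ℝ] ℝ)) 𝓘(ℝ, F) q z' v ∈ D (q z') ↔
      (mvfderiv (𝓘(ℝ, E).prod 𝓘(ℝ, E →L[ℝ] ℝ))
        (extChartAt (𝓘(ℝ, E).prod 𝓘(ℝ, E →L[ℝ] ℝ)) z) z' v).2 = 0

end Foliations

end LagrangianLeaf

end

open LagrangianLeaf

/-! Coordinate changes of `L` are locally `x ↦ A x + c`, so on `T^*L` they are `(x, p) ↦ (A x + c, p
∘ A⁻¹)` with `A` locally constant: a cotangent lift of a linear map followed by a translation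
(`eventually_cotangent_extChartAt_eq`). Such maps preserve both `∑ dxᵢ ∧ dpᵢ` and the subspace `dp =
0`. Adding a locally parallel covector field is itself a translation in these coordinates, so the
whole structure survives division by a parallel field of lattices. `HasCotangentAtlas` isolates this
property of an atlas. It holds for `T^*L` and for the quotient, and it makes the canonical form
symplectic and the horizontal distribution a foliation.

The field of lattices is parallel because paths can be prolonged inside a chart
(`eventually_mem_latticeAt_iff`). Integrality of the holonomy says that at `x₀` it consists of the
covectors integral on the basis `b` (`latticeAt_base`), and connectedness of `L` gives the same
description, with some basis, at every point (`exists_latticeAt_eq`). Such a lattice is closed,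
discrete and cocompact. These properties make the quotient Hausdorff, the projection a local
homeomorphism, and the quotient compact when `L` is.

Along a curve tangent to `dp = 0` the momenta are locally constant, so it cannot leave the zero
section; conversely, smooth curves in `L` lie in the zero section as tangent curves. Hence the zero
section is a leaf (`isLeaf_torusZero`). For its connection, `ω(Y, Z) = Z_p(Y_x)` when `Y_p = 0`.
Differentiating along `X` and subtracting `ω(Y, [X, Z]) = (∂_X Z_p)(Y_x)` leaves `Z_p(∂_X Y_x)`
(`HasCotangentAtlas.weinstein_eq`), which is `ω(∇_X Y, Z)` for the flat `∇`.

Throughout, the tangent space at a point is the model space, by way of the preferred chart at that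
point; an invariant tensor is therefore literally a constant function of the point. -/

noncomputable section

namespace LagrangianLeaf

/-! ### Charts of an affine manifold and their derivatives -/

section Affine

variable {E : Type v} [NormedAddCommGroup E] [NormedSpace ℝ E]
  {L : Type u} [TopologicalSpace L] [ChartedSpace E L] [HasGroupoid L (affineGroupoid E)]

/-- The derivative at `y` of the preferred chart at `x`, where the tangent space at `y` is
identified with `E` by the preferred chart at `y`. -/
def chartDeriv (x y : L) : E →L[ℝ] E := tangentCoordChange 𝓘(ℝ, E) y x y

/-- The inverse of `chartDeriv x y`, for `y` in the source of the chart at `x`. -/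
def chartDerivSymm (x y : L) : E →L[ℝ] E := tangentCoordChange 𝓘(ℝ, E) x y y

theorem chartDeriv_self (x : L) : chartDeriv (E := E) x x = ContinuousLinearMap.id ℝ E := by
  ext1 v
  exact tangentCoordChange_self (mem_extChartAt_source x)

theorem chartDerivSymm_self (x : L) : chartDerivSymm (E := E) x x = ContinuousLinearMap.id ℝ E :=
  chartDeriv_self x

theorem chartDeriv_comp_symm {x y : L} (hy : y ∈ (chartAt E x).source) :
    (chartDeriv (E := E) x y).comp (chartDerivSymm x y) = ContinuousLinearMap.id ℝ E := by
  have hy' : y ∈ (extChartAt 𝓘(ℝ, E) x).source := by rwa [extChartAt_source]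
  ext1 v
  exact (tangentCoordChange_comp ⟨⟨hy', mem_extChartAt_source y⟩, hy'⟩).trans
    (tangentCoordChange_self hy')

theorem chartDerivSymm_comp {x y : L} (hy : y ∈ (chartAt E x).source) :
    (chartDerivSymm (E := E) x y).comp (chartDeriv x y) = ContinuousLinearMap.id ℝ E := by
  have hy' : y ∈ (extChartAt 𝓘(ℝ, E) x).source := by rwa [extChartAt_source]
  ext1 v
  exact (tangentCoordChange_comp
    ⟨⟨mem_extChartAt_source y, hy'⟩, mem_extChartAt_source y⟩).trans
    (tangentCoordChange_self (mem_extChartAt_source y))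

/-- The derivative of a chart, as a linear equivalence. -/
def chartDerivEquiv {x y : L} (hy : y ∈ (chartAt E x).source) : E ≃L[ℝ] E :=
  ContinuousLinearEquiv.equivOfInverse (chartDeriv x y) (chartDerivSymm x y)
    (fun v => DFunLike.congr_fun (chartDerivSymm_comp hy) v)
    (fun v => DFunLike.congr_fun (chartDeriv_comp_symm hy) v)

theorem coe_chartDerivEquiv_symm {x y : L} (hy : y ∈ (chartAt E x).source) :
    ((chartDerivEquiv hy).symm : E →L[ℝ] E) = chartDerivSymm x y := rfl

theorem mfderiv_extChartAt_eq_chartDeriv {x y : L} (hy : y ∈ (chartAt E x).source) :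
    mfderiv 𝓘(ℝ, E) 𝓘(ℝ, E) (extChartAt 𝓘(ℝ, E) x) y = chartDeriv (E := E) x y := by
  rw [← TangentBundle.continuousLinearMapAt_trivializationAt hy,
    TangentBundle.continuousLinearMapAt_trivializationAt_eq_core hy]
  rfl

theorem mvfderiv_extChartAt_eq_chartDeriv {x y : L} (hy : y ∈ (chartAt E x).source) (v : E) :
    mvfderiv 𝓘(ℝ, E) (extChartAt 𝓘(ℝ, E) x) y v = chartDeriv (E := E) x y v :=
  DFunLike.congr_fun (mfderiv_extChartAt_eq_chartDeriv hy) v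

/-- Coordinate changes are locally affine, and their linear part is `chartDeriv`. -/
theorem eventually_chart_eq {x y₀ : L} (hy₀ : y₀ ∈ (chartAt E x).source) :
    ∃ c : E, ∀ᶠ y in 𝓝 y₀,
      chartAt E x y = chartDeriv x y₀ (chartAt E y₀ y) + c ∧
      chartDeriv (E := E) x y = (chartDeriv x y₀).comp (chartDeriv y₀ y) := by
  have hG := HasGroupoid.compatible (G := affineGroupoid E) (chart_mem_atlas E y₀)
    (chart_mem_atlas E x)
  have hP := (mem_groupoid_of_pregroupoid.1 hG).1
  have hs : chartAt E y₀ y₀ ∈ ((chartAt E y₀).symm ≫ₕ chartAt E x).source := by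
    simp [hy₀]
  obtain ⟨A, hA⟩ := hP _ hs
  rw [((chartAt E y₀).symm ≫ₕ chartAt E x).open_source.nhdsWithin_eq hs] at hA
  have hD : ∀ᶠ u in 𝓝 (chartAt E y₀ y₀),
      fderivWithin ℝ (extChartAt 𝓘(ℝ, E) x ∘ (extChartAt 𝓘(ℝ, E) y₀).symm)
        (range 𝓘(ℝ, E)) u = A.contLinear := by
    filter_upwards [hA.eventually_nhds] with u hu
    rw [modelWithCornersSelf_coe, range_id, fderivWithin_univ]
    have : extChartAt 𝓘(ℝ, E) x ∘ (extChartAt 𝓘(ℝ, E) y₀).symm =ᶠ[𝓝 u] A := hu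
    rw [this.fderiv_eq]
    exact A.hasFDerivAt.fderiv
  have hcont : Tendsto (chartAt E y₀) (𝓝 y₀) (𝓝 (chartAt E y₀ y₀)) :=
    (chartAt E y₀).continuousAt (mem_chart_source E y₀)
  have h0 : chartDeriv (E := E) x y₀ = A.contLinear := hD.self_of_nhds
  refine ⟨A 0, ?_⟩
  filter_upwards [hcont.eventually hD, hcont.eventually hA,
    (chartAt E y₀).open_source.mem_nhds (mem_chart_source E y₀),
    (chartAt E x).open_source.mem_nhds hy₀] with y h1 h2 h3 h4
  constructor
  · rw [h0]
    have : chartAt E x y = A (chartAt E y₀ y) := by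
      rw [← h2]
      simp [h3]
    rw [this]
    have := A.decomp
    exact congr_fun this _
  · ext1 v
    have : tangentCoordChange 𝓘(ℝ, E) y₀ x y (tangentCoordChange 𝓘(ℝ, E) y y₀ y v)
        = tangentCoordChange 𝓘(ℝ, E) y x y v :=
      tangentCoordChange_comp ⟨⟨mem_extChartAt_source y, by rwa [extChartAt_source]⟩,
        by rwa [extChartAt_source]⟩
    rw [h0, ← h1]
    exact this.symm

/-- Vectors with constant coordinates in one affine chart have locally constant coordinates in any
other. This is the source of all local parallelism below. -/
theorem eventually_chartDeriv_comp_symm {x y₀ : L} (hy₀ : y₀ ∈ (chartAt E x).source) :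
    ∀ᶠ y in 𝓝 y₀, (chartDeriv (E := E) y₀ y).comp (chartDerivSymm x y) =
      chartDerivSymm x y₀ := by
  obtain ⟨c, hc⟩ := eventually_chart_eq hy₀
  filter_upwards [hc, (chartAt E x).open_source.mem_nhds hy₀] with y hy h1
  have h3 := chartDeriv_comp_symm h1
  rw [hy.2, ContinuousLinearMap.comp_assoc] at h3
  calc (chartDeriv (E := E) y₀ y).comp (chartDerivSymm x y)
      = ((chartDerivSymm x y₀).comp (chartDeriv x y₀)).comp
          ((chartDeriv (E := E) y₀ y).comp (chartDerivSymm x y)) := by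
        rw [chartDerivSymm_comp hy₀, ContinuousLinearMap.id_comp]
    _ = chartDerivSymm x y₀ := by
        rw [ContinuousLinearMap.comp_assoc, h3, ContinuousLinearMap.comp_id]

/-! ### Coordinates on the cotangent bundle -/

/-- The covector at a point of the cotangent bundle, in the preferred chart at its base point. -/
def covector (z : CotangentBundle E L) : E →L[ℝ] ℝ := z.snd

/-- The point of the cotangent bundle over `x` that has the momentum `p` in the preferred chart
at `x`. -/
def ofCovector (x : L) (p : E →L[ℝ] ℝ) : CotangentBundle E L := ⟨x, p⟩

local notation "IT" => ModelWithCorners.prod 𝓘(ℝ, E) 𝓘(ℝ, E →L[ℝ] ℝ)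

theorem cotangent_extChartAt_source (z : CotangentBundle E L) :
    (extChartAt IT z).source = TotalSpace.proj ⁻¹' (chartAt E z.proj).source := by
  rw [FiberBundle.extChartAt]
  ext w
  simp only [mfld_simps, hom_trivializationAt_source]
  constructor
  · exact fun h => h.1.1
  · exact fun h => ⟨⟨h, trivial⟩, h⟩

theorem cotangent_extChartAt_target (z : CotangentBundle E L) :
    (extChartAt IT z).target = (chartAt E z.proj).target ×ˢ univ := by
  rw [FiberBundle.extChartAt_target]
  ext w
  simp only [mfld_simps, hom_trivializationAt_baseSet]
  constructor
  · exact fun h => h.1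
  · exact fun h => ⟨h, (chartAt E z.proj).map_target h, trivial⟩

/-- Unfolds the chart of the bundle of continuous linear maps: the trivialization precomposes with
the inverse of the tangent coordinate change, and the trivial target bundle contributes nothing. -/
theorem cotangent_extChartAt_apply (z w : CotangentBundle E L)
    (hw : w.proj ∈ (chartAt E z.proj).source) :
    extChartAt IT z w =
      (chartAt E z.proj w.proj, (covector w).comp (chartDerivSymm z.proj w.proj)) := by
  rw [extChartAt_coe]
  simp only [Function.comp, hom_chart]
  refine Prod.ext rfl ?_
  ext v
  have h := TangentBundle.symmL_trivializationAt_eq_core (I := 𝓘(ℝ, E)) hw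
  change (ContinuousLinearMap.inCoordinates E (TangentSpace 𝓘(ℝ, E)) ℝ (Bundle.Trivial L ℝ)
    z.proj w.proj z.proj w.proj w.snd) v = _
  rw [ContinuousLinearMap.inCoordinates, h]
  change ((Bundle.Trivial.trivialization L ℝ).continuousLinearMapAt ℝ w.proj) _ = _
  rw [Bundle.Trivial.continuousLinearMapAt_trivialization]
  rfl

theorem cotangent_extChartAt_symm_apply (z : CotangentBundle E L) {u : E} {p : E →L[ℝ] ℝ}
    (hu : u ∈ (chartAt E z.proj).target) :
    (extChartAt IT z).symm (u, p) = ofCovector ((chartAt E z.proj).symm u)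
      (p.comp (chartDeriv z.proj ((chartAt E z.proj).symm u))) := by
  have hy : (chartAt E z.proj).symm u ∈ (chartAt E z.proj).source :=
    (chartAt E z.proj).map_target hu
  set w := ofCovector ((chartAt E z.proj).symm u)
      (p.comp (chartDeriv z.proj ((chartAt E z.proj).symm u))) with hw
  have h1 : extChartAt IT z w = (u, p) := by
    rw [cotangent_extChartAt_apply z w hy]
    refine Prod.ext ((chartAt E z.proj).right_inv hu) ?_
    change (p.comp (chartDeriv z.proj ((chartAt E z.proj).symm u))).comp
      (chartDerivSymm z.proj ((chartAt E z.proj).symm u)) = p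
    rw [ContinuousLinearMap.comp_assoc, chartDeriv_comp_symm hy]
    rfl
  rw [← h1]
  refine (extChartAt IT z).left_inv ?_
  rw [cotangent_extChartAt_source]
  exact hy

/-- The action of a linear change of coordinates on positions and momenta. -/
def cotangentLift (a : E ≃L[ℝ] E) : (E × (E →L[ℝ] ℝ)) ≃L[ℝ] (E × (E →L[ℝ] ℝ)) :=
  a.prodCongr (a.arrowCongr (ContinuousLinearEquiv.refl ℝ ℝ))

theorem cotangentLift_apply (a : E ≃L[ℝ] E) (y : E × (E →L[ℝ] ℝ)) :
    cotangentLift a y = (a y.1, y.2.comp (a.symm : E →L[ℝ] E)) := by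
  refine Prod.ext rfl ?_
  ext v
  rfl

theorem continuous_cotangent_proj :
    Continuous (TotalSpace.proj : CotangentBundle E L → L) :=
  FiberBundle.continuous_proj (E →L[ℝ] ℝ) (fun x : L => TangentSpace 𝓘(ℝ, E) x →L[ℝ] ℝ)

/-- The natural coordinates on the cotangent bundle change by cotangent lifts and translations. -/
theorem eventually_cotangent_extChartAt_eq {z z₀ : CotangentBundle E L}
    (h : z₀ ∈ (extChartAt IT z).source) :
    ∃ (a : E ≃L[ℝ] E) (c : E × (E →L[ℝ] ℝ)), ∀ᶠ w in 𝓝 z₀,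
      extChartAt IT z w = cotangentLift a (extChartAt IT z₀ w) + c := by
  rw [cotangent_extChartAt_source] at h
  have h : z₀.proj ∈ (chartAt E z.proj).source := h
  obtain ⟨c, hc⟩ := eventually_chart_eq h
  refine ⟨chartDerivEquiv h, (c, 0), ?_⟩
  filter_upwards [continuous_cotangent_proj.continuousAt.eventually hc,
    continuous_cotangent_proj.continuousAt.eventually
      ((chartAt E z.proj).open_source.mem_nhds h),
    continuous_cotangent_proj.continuousAt.eventually
      ((chartAt E z₀.proj).open_source.mem_nhds (mem_chart_source E z₀.proj)),
    continuous_cotangent_proj.continuousAt.eventually (eventually_chartDeriv_comp_symm h)]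
    with w hw h1 h2 h3
  rw [cotangent_extChartAt_apply z w h1, cotangent_extChartAt_apply z₀ w h2, cotangentLift_apply,
    coe_chartDerivEquiv_symm]
  refine Prod.ext hw.1 ?_
  change (covector w).comp _ = ((covector w).comp _).comp _ + 0
  rw [add_zero, ContinuousLinearMap.comp_assoc]
  congr 1
  calc chartDerivSymm z.proj w.proj
      = ((chartDerivSymm z₀.proj w.proj).comp (chartDeriv z₀.proj w.proj)).comp
          (chartDerivSymm z.proj w.proj) := by
        rw [chartDerivSymm_comp h2, ContinuousLinearMap.id_comp]
    _ = (chartDerivSymm z₀.proj w.proj).comp (chartDerivSymm z.proj z₀.proj) := by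
        rw [ContinuousLinearMap.comp_assoc, h3]

end Affine

/-! ### Existence, uniqueness and concatenation of parallel transport -/

section ParallelTransport

variable {E : Type v} [NormedAddCommGroup E] [NormedSpace ℝ E]
  {L : Type u} [TopologicalSpace L] [ChartedSpace E L] [HasGroupoid L (affineGroupoid E)]

/-- `W` is a parallel vector field along `γ`; its value at `t` is given in the preferred chart
at `γ t`. -/
def IsParallelField (γ : unitInterval → L) (W : unitInterval → E) : Prop :=
  ∀ t₀, ∀ᶠ t in 𝓝 t₀, chartDeriv (γ t₀) (γ t) (W t) = W t₀

/-- Trades sections of the tangent bundle for functions with values in the model space; the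
derivative of the preferred chart at its own centre is the identity. -/
theorem isParallelTransport_iff {x y : L} (γ : Path x y) (v w : E) :
    IsParallelTransport (E := E) γ v w ↔
      ∃ W : unitInterval → E, IsParallelField γ W ∧ W 0 = v ∧ W 1 = w := by
  have hnear (t₀ : unitInterval) : ∀ᶠ t in 𝓝 t₀, γ t ∈ (chartAt E (γ t₀)).source :=
    γ.continuous.continuousAt.eventually
      ((chartAt E (γ t₀)).open_source.mem_nhds (mem_chart_source E (γ t₀)))
  constructor
  · rintro ⟨V, hV, hpar, h0, h1⟩
    refine ⟨fun t => (V t).snd, fun t₀ => ?_, ?_, ?_⟩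
    · filter_upwards [hpar t₀, hnear t₀] with t ht ht'
      rw [← hV t, ← hV t₀] at ht'
      have e1 := mvfderiv_extChartAt_eq_chartDeriv ht' ((V t).snd)
      have e2 := mvfderiv_extChartAt_eq_chartDeriv (mem_chart_source E (V t₀).proj) ((V t₀).snd)
      rw [chartDeriv_self] at e2
      rw [← hV t, ← hV t₀]
      exact e1.symm.trans (ht.trans e2)
    · exact congrArg (fun p : TangentBundle 𝓘(ℝ, E) L => (p.snd : E)) h0
    · exact congrArg (fun p : TangentBundle 𝓘(ℝ, E) L => (p.snd : E)) h1
  · rintro ⟨W, hW, h0, h1⟩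
    have key : ∀ {x y : L} {v w : E}, x = y → v = w →
        (⟨x, v⟩ : TangentBundle 𝓘(ℝ, E) L) = ⟨y, w⟩ := by
      rintro x _ v _ rfl rfl
      rfl
    refine ⟨fun t => ⟨γ t, W t⟩, fun t => rfl, fun t₀ => ?_, key γ.source h0, key γ.target h1⟩
    filter_upwards [hW t₀, hnear t₀] with t ht ht'
    have e1 := mvfderiv_extChartAt_eq_chartDeriv ht' (W t)
    have e2 := mvfderiv_extChartAt_eq_chartDeriv (mem_chart_source E (γ t₀)) (W t₀)
    rw [chartDeriv_self] at e2
    exact e1.trans (ht.trans e2.symm)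

/-- Chart derivatives are injective, so agreement and disagreement are both open conditions on the
connected unit interval. -/
theorem IsParallelField.eq_of_eq_zero {γ : unitInterval → L} (hγ : Continuous γ)
    {W W' : unitInterval → E} (hW : IsParallelField γ W) (hW' : IsParallelField γ W')
    (h0 : W 0 = W' 0) : W = W' := by
  have hnear (t₀ : unitInterval) : ∀ᶠ t in 𝓝 t₀, W t = W' t ↔ W t₀ = W' t₀ := by
    filter_upwards [hW t₀, hW' t₀, hγ.continuousAt.eventually
      ((chartAt E (γ t₀)).open_source.mem_nhds (mem_chart_source E (γ t₀)))] with t h1 h2 h3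
    rw [← h1, ← h2]
    exact ((chartDerivEquiv h3).injective.eq_iff).symm
  have hcl : IsClopen {t | W t = W' t} := by
    constructor
    · rw [← isOpen_compl_iff, isOpen_iff_mem_nhds]
      intro t₀ ht₀
      filter_upwards [hnear t₀] with t ht
      exact fun h => ht₀ (ht.1 h)
    · rw [isOpen_iff_mem_nhds]
      intro t₀ ht₀
      filter_upwards [hnear t₀] with t ht
      exact ht.2 ht₀
  have huniv := hcl.eq_univ ⟨0, h0⟩
  funext t
  exact huniv.ge (mem_univ t)

theorem IsParallelTransport.unique {x y : L} {γ : Path x y} {v w w' : E}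
    (h : IsParallelTransport (E := E) γ v w) (h' : IsParallelTransport (E := E) γ v w') :
    w = w' := by
  obtain ⟨W, hW, h0, h1⟩ := (isParallelTransport_iff γ v w).1 h
  obtain ⟨W', hW', h0', h1'⟩ := (isParallelTransport_iff γ v w').1 h'
  rw [← h1, ← h1', hW.eq_of_eq_zero γ.continuous hW' (h0.trans h0'.symm)]

theorem isParallelTransport_refl (x : L) (v : E) :
    IsParallelTransport (E := E) (Path.refl x) v v := by
  refine (isParallelTransport_iff _ v v).2 ⟨fun _ => v, fun t₀ => Eventually.of_forall fun t => ?_,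
    rfl, rfl⟩
  change chartDeriv x x v = v
  rw [chartDeriv_self]
  rfl

/-- Along a path in the domain of a chart, the parallel fields are those with constant coordinates
in this chart. -/
theorem isParallelTransport_of_mem_chart (x : L) {y y' : L} (γ : Path y y')
    (hγ : ∀ t, γ t ∈ (chartAt E x).source) {w w' : E}
    (h : chartDeriv x y w = chartDeriv x y' w') : IsParallelTransport (E := E) γ w w' := by
  refine (isParallelTransport_iff _ _ _).2
    ⟨fun t => chartDerivSymm x (γ t) (chartDeriv x y w), fun t₀ => ?_, ?_, ?_⟩
  · filter_upwards [γ.continuous.continuousAt.eventually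
      (eventually_chartDeriv_comp_symm (hγ t₀))] with t ht
    exact DFunLike.congr_fun ht _
  · have h0 := hγ 0
    rw [γ.source] at h0
    simp only [γ.source]
    exact DFunLike.congr_fun (chartDerivSymm_comp h0) w
  · have h1 := hγ 1
    rw [γ.target] at h1
    simp only [γ.target]
    rw [h]
    exact DFunLike.congr_fun (chartDerivSymm_comp h1) w'

theorem IsParallelTransport.trans {x y z : L} {γ : Path x y} {δ : Path y z} {u v w : E}
    (h : IsParallelTransport (E := E) γ u v) (h' : IsParallelTransport (E := E) δ v w) :
    IsParallelTransport (E := E) (γ.trans δ) u w := by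
  obtain ⟨V, hV, hV0, hV1⟩ := (isParallelTransport_iff _ _ _).1 h
  obtain ⟨W, hW, hW0, hW1⟩ := (isParallelTransport_iff _ _ _).1 h'
  let f : unitInterval → unitInterval := fun t => projIcc 0 1 zero_le_one (2 * (t : ℝ))
  let g : unitInterval → unitInterval := fun t => projIcc 0 1 zero_le_one (2 * (t : ℝ) - 1)
  have hf : Continuous f := continuous_projIcc.comp (by fun_prop)
  have hg : Continuous g := continuous_projIcc.comp (by fun_prop)
  have f1 : ∀ t : unitInterval, (1 / 2 : ℝ) ≤ t → f t = 1 := fun t ht =>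
    projIcc_of_right_le _ (by linarith)
  have g0 : ∀ t : unitInterval, (t : ℝ) ≤ 1 / 2 → g t = 0 := fun t ht =>
    projIcc_of_le_left _ (by linarith)
  have hγδ : ∀ t, (γ.trans δ) t = if (t : ℝ) ≤ 1 / 2 then γ (f t) else δ (g t) := fun t => rfl
  let U : unitInterval → E := fun t => if (t : ℝ) ≤ 1 / 2 then V (f t) else W (g t)
  have U1 : ∀ t : unitInterval, (t : ℝ) ≤ 1 / 2 →
      (γ.trans δ) t = γ (f t) ∧ U t = V (f t) := fun t ht => by
    rw [hγδ, if_pos ht]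
    exact ⟨rfl, if_pos ht⟩
  have U2 : ∀ t : unitInterval, (1 / 2 : ℝ) ≤ t →
      (γ.trans δ) t = δ (g t) ∧ U t = W (g t) := fun t ht => by
    rcases ht.lt_or_eq with ht | ht
    · rw [hγδ, if_neg (not_le.2 ht)]
      exact ⟨rfl, if_neg (not_le.2 ht)⟩
    · obtain ⟨h1, h2⟩ := U1 t ht.ge
      rw [h1, h2, f1 t ht.le, g0 t ht.ge, γ.target, δ.source, hV1, hW0]
      exact ⟨rfl, rfl⟩
  have hU : IsParallelField (γ.trans δ) U := by
    intro t₀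
    have hl : ∀ᶠ t : unitInterval in 𝓝 t₀, (t₀ : ℝ) ≤ 1 / 2 → (t : ℝ) ≤ 1 / 2 →
        chartDeriv ((γ.trans δ) t₀) ((γ.trans δ) t) (U t) = U t₀ := by
      filter_upwards [hf.continuousAt.eventually (hV (f t₀))] with t ht h1 h2
      rw [(U1 t h2).1, (U1 t h2).2, (U1 t₀ h1).1, (U1 t₀ h1).2]
      exact ht
    have hr : ∀ᶠ t : unitInterval in 𝓝 t₀, (1 / 2 : ℝ) ≤ t₀ → (1 / 2 : ℝ) ≤ t →
        chartDeriv ((γ.trans δ) t₀) ((γ.trans δ) t) (U t) = U t₀ := by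
      filter_upwards [hg.continuousAt.eventually (hW (g t₀))] with t ht h1 h2
      rw [(U2 t h2).1, (U2 t h2).2, (U2 t₀ h1).1, (U2 t₀ h1).2]
      exact ht
    have hcoe : ContinuousAt (fun t : unitInterval => (t : ℝ)) t₀ :=
      continuous_subtype_val.continuousAt
    -- At the junction the one-sided statements `hl` and `hr` are both available and together cover
    -- a neighbourhood.
    rcases lt_trichotomy (t₀ : ℝ) (1 / 2) with h | h | h
    · filter_upwards [hl, hcoe.eventually (eventually_lt_nhds h)] with t ht h'
      exact ht h.le h'.le
    · filter_upwards [hl, hr] with t h1 h2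
      rcases le_total (t : ℝ) (1 / 2) with h' | h'
      · exact h1 h.le h'
      · exact h2 h.ge h'
    · filter_upwards [hr, hcoe.eventually (eventually_gt_nhds h)] with t ht h'
      exact ht h.le h'.le
  refine (isParallelTransport_iff _ _ _).2 ⟨U, hU, ?_, ?_⟩
  · rw [(U1 0 (by norm_num)).2, ← hV0]
    congr 1
    exact projIcc_of_le_left _ (by norm_num)
  · rw [(U2 1 (by norm_num)).2, ← hW1]
    congr 1
    exact projIcc_of_right_le _ (by norm_num)

/-- Parallel transport exists along every path, and is a linear isomorphism. -/
theorem exists_parallelTransport {x y : L} (γ : Path x y) :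
    ∃ A : E ≃L[ℝ] E, ∀ v, IsParallelTransport (E := E) γ v (A v) := by
  -- Subdivide the interval so that each piece of the path lies in one chart, then extend the
  -- transport piece by piece; parallelism is claimed only up to time `t n`.
  obtain ⟨t, ht0, hmono, ⟨N, hN⟩, hcov⟩ := exists_monotone_Icc_subset_open_cover_unitInterval
    (c := fun x : L => γ ⁻¹' (chartAt E x).source)
    (fun x => (chartAt E x).open_source.preimage γ.continuous)
    (fun s _ => mem_iUnion.2 ⟨γ s, mem_chart_source E (γ s)⟩)
  have main : ∀ n, ∃ W : unitInterval → E ≃L[ℝ] E, W 0 = ContinuousLinearEquiv.refl ℝ E ∧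
      ∀ s₀ ≤ t n, ∀ᶠ s in 𝓝 s₀, s ≤ t n →
        ∀ v, chartDeriv (γ s₀) (γ s) (W s v) = W s₀ v := by
    intro n
    induction n with
    | zero =>
      refine ⟨fun _ => ContinuousLinearEquiv.refl ℝ E, rfl, fun s₀ h₀ =>
        Eventually.of_forall fun s h v => ?_⟩
      rw [ht0] at h₀ h
      rw [le_antisymm h₀ unitInterval.nonneg', le_antisymm h unitInterval.nonneg', chartDeriv_self]
      rfl
    | succ n ih =>
      obtain ⟨W, hW0, hW⟩ := ih
      obtain ⟨c, hc⟩ := hcov n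
      have hn : γ (t n) ∈ (chartAt E c).source := hc ⟨le_rfl, hmono n.le_succ⟩
      classical
      -- Continue with constant coordinates in the chart at `c`. The identity is a dummy value for
      -- times when the path is outside that chart, which does not happen up to `t (n + 1)`.
      let W' : unitInterval → E ≃L[ℝ] E := fun s => if s ≤ t n then W s else
        if h : γ s ∈ (chartAt E c).source then
          (W (t n)).trans ((chartDerivEquiv hn).trans (chartDerivEquiv h).symm)
        else ContinuousLinearEquiv.refl ℝ E
      have W1 : ∀ s ≤ t n, W' s = W s := fun s hs => if_pos hs
      have W2 : ∀ s, t n ≤ s → s ≤ t (n + 1) → ∀ v,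
          W' s v = chartDerivSymm c (γ s) (chartDeriv c (γ (t n)) (W (t n) v)) := by
        intro s hs hs' v
        rcases hs.lt_or_eq with h | rfl
        · have hm : γ s ∈ (chartAt E c).source := hc ⟨hs, hs'⟩
          simp only [W', if_neg (not_le.2 h), dif_pos hm]
          rfl
        · rw [W1 _ le_rfl]
          exact (DFunLike.congr_fun (chartDerivSymm_comp hn) _).symm
      refine ⟨W', by rw [W1 0 unitInterval.nonneg', hW0], fun s₀ hs₀ => ?_⟩
      have hl : s₀ ≤ t n → ∀ᶠ s in 𝓝 s₀, s ≤ t n →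
          ∀ v, chartDeriv (γ s₀) (γ s) (W' s v) = W' s₀ v := fun h => by
        filter_upwards [hW s₀ h] with s hs h' v
        rw [W1 s h', W1 s₀ h]
        exact hs h' v
      have hr : t n ≤ s₀ → ∀ᶠ s in 𝓝 s₀, t n ≤ s → s ≤ t (n + 1) →
          ∀ v, chartDeriv (γ s₀) (γ s) (W' s v) = W' s₀ v := fun h => by
        have hm : γ s₀ ∈ (chartAt E c).source := hc ⟨h, hs₀⟩
        filter_upwards [γ.continuous.continuousAt.eventually
          (eventually_chartDeriv_comp_symm hm)] with s hs h1 h2 v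
        rw [W2 s h1 h2, W2 s₀ h hs₀]
        exact DFunLike.congr_fun hs _
      rcases lt_trichotomy s₀ (t n) with h | h | h
      · filter_upwards [hl h.le, eventually_lt_nhds h] with s hs h' _
        exact hs h'.le
      · filter_upwards [hl h.le, hr h.ge] with s h1 h2 h3
        rcases le_total s (t n) with h' | h'
        · exact h1 h'
        · exact h2 h' h3
      · filter_upwards [hr h.le, eventually_gt_nhds h] with s hs h'
        exact hs h'.le
  obtain ⟨W, hW0, hW⟩ := main N
  rw [hN N le_rfl] at hW
  refine ⟨W 1, fun v => (isParallelTransport_iff _ _ _).2 ⟨fun s => W s v, fun s₀ => ?_, ?_, rfl⟩⟩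
  · filter_upwards [hW s₀ unitInterval.le_one'] with s hs
    exact hs unitInterval.le_one' v
  · exact congrArg (fun A : E ≃L[ℝ] E => A v) hW0

end ParallelTransport

/-! ### The field of lattices -/

section Lattice

variable {E : Type v} [NormedAddCommGroup E] [NormedSpace ℝ E]

/-- The covectors that are integral on the vectors of a family. -/
def integralCovectors {n : ℕ} (B : Fin n → E) : Set (E →L[ℝ] ℝ) :=
  {p | ∀ i, ∃ k : ℤ, p (B i) = k}

theorem isClosed_integralCovectors {n : ℕ} (B : Fin n → E) : IsClosed (integralCovectors B) := by
  have : integralCovectors B = ⋂ i, (fun p : E →L[ℝ] ℝ => p (B i)) ⁻¹' range ((↑) : ℤ → ℝ) := by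
    ext p
    simp [integralCovectors, eq_comm]
  rw [this]
  exact isClosed_iInter fun i => Int.isClosedEmbedding_coe_real.isClosed_range.preimage
    (ContinuousLinearMap.apply ℝ ℝ (B i)).continuous

/-- Discreteness: a covector near zero takes values of absolute value less than one on the basis,
and an integer of that size is zero. -/
theorem eventually_integralCovectors_eq_zero {n : ℕ} (B : Module.Basis (Fin n) ℝ E) :
    ∀ᶠ p in 𝓝 (0 : E →L[ℝ] ℝ), p ∈ integralCovectors B → p = 0 := by
  have h1 : ∀ᶠ p in 𝓝 (0 : E →L[ℝ] ℝ), ∀ i, |p (B i)| < 1 := by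
    rw [eventually_all]
    intro i
    have hc : ContinuousAt (fun p : E →L[ℝ] ℝ => |p (B i)|) 0 :=
      (ContinuousLinearMap.apply ℝ ℝ (B i)).continuous.abs.continuousAt
    refine hc.eventually (eventually_lt_nhds ?_)
    simp
  filter_upwards [h1] with p hp hint
  have : (p : E →ₗ[ℝ] ℝ) = 0 := by
    refine B.ext fun i => ?_
    obtain ⟨k, hk⟩ := hint i
    have := hp i
    rw [hk, ← Int.cast_abs, ← Int.cast_one, Int.cast_lt, Int.abs_lt_one_iff] at this
    simp [hk, this]
  ext v
  exact DFunLike.congr_fun this v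

theorem exists_isCompact_add_integralCovectors {n : ℕ} (B : Module.Basis (Fin n) ℝ E) :
    ∃ C : Set (E →L[ℝ] ℝ), IsCompact C ∧ ∀ p, ∃ c ∈ C, p - c ∈ integralCovectors B := by
  have : FiniteDimensional ℝ E := B.finiteDimensional_of_finite
  let e : (E →L[ℝ] ℝ) ≃ₗ[ℝ] (Fin n → ℝ) :=
    (LinearMap.toContinuousLinearMap (𝕜 := ℝ) (E := E) (F' := ℝ)).symm.trans
      (B.constr ℝ).symm
  have he : ∀ p i, e p i = p (B i) := fun p i => rfl
  let e' := e.toContinuousLinearEquiv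
  -- The unit cube in the dual coordinates; a covector is moved into it by taking fractional parts.
  refine ⟨e'.symm '' (univ.pi fun _ => Icc 0 1), ?_, fun p => ?_⟩
  · exact (isCompact_univ_pi fun _ => isCompact_Icc).image e'.symm.continuous
  · refine ⟨e'.symm fun i => Int.fract (p (B i)), mem_image_of_mem _ fun i _ =>
      ⟨Int.fract_nonneg _, (Int.fract_lt_one _).le⟩, fun i => ⟨⌊p (B i)⌋, ?_⟩⟩
    have h : (e'.symm fun i => Int.fract (p (B i))) (B i) = Int.fract (p (B i)) := by
      rw [← he]
      exact congr_fun (e.apply_symm_apply _) i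
    rw [sub_apply, h]
    exact Int.self_sub_fract _

variable {L : Type u} [TopologicalSpace L] [ChartedSpace E L] {n : ℕ} {x₀ : L}

/-- The lattice of covectors at `x`, in the preferred chart at `x`. -/
def latticeAt (b : Module.Basis (Fin n) ℝ (TangentSpace 𝓘(ℝ, E) x₀)) (x : L) :
    Set (E →L[ℝ] ℝ) :=
  cotangentLattice b x

variable [HasGroupoid L (affineGroupoid E)]

/-- The field of lattices is parallel. -/
theorem eventually_mem_latticeAt_iff (b : Module.Basis (Fin n) ℝ (TangentSpace 𝓘(ℝ, E) x₀))
    (x : L) : ∀ᶠ y in 𝓝 x, ∀ p : E →L[ℝ] ℝ,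
      p ∈ latticeAt b x ↔ p.comp (chartDeriv x y) ∈ latticeAt b y := by
  have : LocallyPathConnectedSpace L := ChartedSpace.locallyPathConnectedSpace E L
  have hs := (chartAt E x).open_source.mem_nhds (mem_chart_source E x)
  filter_upwards [pathComponentIn_mem_nhds hs] with y hy p
  obtain ⟨γ, hγ⟩ : JoinedIn (chartAt E x).source x y := hy
  have hy' : y ∈ (chartAt E x).source := by simpa using hγ 1
  constructor
  · intro hp δ i (w : E) hw
    -- Transport back to `x` along `γ` reversed, inside the chart; integrality on the result is
    -- integrality of the transported covector on `w`.
    let w' : E := chartDeriv x y w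
    have h1 : IsParallelTransport (E := E) γ.symm w w' :=
      isParallelTransport_of_mem_chart x γ.symm (fun t => hγ _) (by rw [chartDeriv_self]; rfl)
    exact hp (δ.trans γ.symm) i _ (hw.trans h1)
  · intro hp δ i (w : E) hw
    let w' : E := chartDerivSymm x y w
    have h1 : IsParallelTransport (E := E) γ w w' := by
      refine isParallelTransport_of_mem_chart x γ hγ ?_
      rw [chartDeriv_self]
      exact (DFunLike.congr_fun (chartDeriv_comp_symm hy') w).symm
    obtain ⟨k, hk⟩ := hp (δ.trans γ) i _ (hw.trans h1)
    refine ⟨k, Eq.trans ?_ hk⟩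
    exact congrArg p (DFunLike.congr_fun (chartDeriv_comp_symm hy') w).symm

/-- The constant loop gives one inclusion. For the other, transport along a loop takes each basis
vector to an integral combination of the basis; this is where integrality of the holonomy enters. -/
theorem latticeAt_base {b : Module.Basis (Fin n) ℝ (TangentSpace 𝓘(ℝ, E) x₀)}
    (hb : HasIntegralLinearHolonomy b) :
    latticeAt b x₀ = integralCovectors (E := E) (fun i => b i) := by
  ext p
  constructor
  · exact fun hp i => hp (Path.refl x₀) i (b i) (isParallelTransport_refl (E := E) x₀ (b i))
  · intro hp γ i w hw
    obtain ⟨A, hA⟩ := exists_parallelTransport (E := E) γ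
    let A' : TangentSpace 𝓘(ℝ, E) x₀ ≃ₗ[ℝ] TangentSpace 𝓘(ℝ, E) x₀ := A.toLinearEquiv
    obtain ⟨B, hB⟩ := hb A' ⟨γ, hA⟩
    have hw' : w = A' (b i) := hw.unique (hA (b i))
    choose k hk using hp
    refine ⟨∑ j, (B : Matrix (Fin n) (Fin n) ℤ) j i * k j, ?_⟩
    have h1 : A' (b i) = ∑ j, ((B : Matrix (Fin n) (Fin n) ℤ) j i : ℝ) • b j := by
      rw [← b.sum_repr (A' (b i))]
      refine Finset.sum_congr rfl fun j _ => ?_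
      congr 1
      have := congr_fun (congr_fun hB j) i
      rw [LinearMap.toMatrix_apply] at this
      exact this
    rw [hw', h1]
    push_cast
    refine (map_sum (p : E →L[ℝ] ℝ) _ _).trans (Finset.sum_congr rfl fun j _ => ?_)
    rw [← hk j]
    exact map_smul p _ _

/-- A basis that describes the lattice at one point can be carried by the chart derivative to nearby
points, and back. So the points with such a basis form a clopen set, which contains `x₀`. -/
theorem exists_latticeAt_eq [ConnectedSpace L]
    {b : Module.Basis (Fin n) ℝ (TangentSpace 𝓘(ℝ, E) x₀)}
    (hb : HasIntegralLinearHolonomy b) (x : L) :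
    ∃ B : Module.Basis (Fin n) ℝ E, latticeAt b x = integralCovectors B := by
  have hnear (x : L) : ∀ᶠ y in 𝓝 x,
      (∃ B : Module.Basis (Fin n) ℝ E, latticeAt b x = integralCovectors B) ↔
        ∃ B : Module.Basis (Fin n) ℝ E, latticeAt b y = integralCovectors B := by
    filter_upwards [eventually_mem_latticeAt_iff b x,
      (chartAt E x).open_source.mem_nhds (mem_chart_source E x)] with y hy hys
    constructor
    · rintro ⟨B, hB⟩
      refine ⟨B.map (chartDerivEquiv hys).symm.toLinearEquiv, ?_⟩
      ext p
      have h1 : p = (p.comp (chartDerivSymm x y)).comp (chartDeriv x y) := by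
        rw [ContinuousLinearMap.comp_assoc, chartDerivSymm_comp hys, ContinuousLinearMap.comp_id]
      rw [h1, ← hy, hB, ← h1]
      rfl
    · rintro ⟨B, hB⟩
      refine ⟨B.map (chartDerivEquiv hys).toLinearEquiv, ?_⟩
      ext p
      rw [hy, hB]
      rfl
  have hcl : IsClopen {x : L | ∃ B : Module.Basis (Fin n) ℝ E,
      latticeAt b x = integralCovectors B} := by
    constructor
    · rw [← isOpen_compl_iff, isOpen_iff_mem_nhds]
      intro x hx
      filter_upwards [hnear x] with y hy
      exact fun h => hx (hy.2 h)
    · rw [isOpen_iff_mem_nhds]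
      intro x hx
      filter_upwards [hnear x] with y hy
      exact hy.1 hx
  have h0 : ∃ B : Module.Basis (Fin n) ℝ E, latticeAt b x₀ = integralCovectors B :=
    ⟨b, latticeAt_base hb⟩
  exact (hcl.eq_univ ⟨x₀, h0⟩).ge (mem_univ x)

end Lattice

/-! ### The torus bundle as a topological space -/

section Quotient

variable {E : Type v} [NormedAddCommGroup E] [NormedSpace ℝ E]
  {L : Type u} [TopologicalSpace L] [ChartedSpace E L] {n : ℕ} {x₀ : L}

theorem latticeAt_zero_mem (b : Module.Basis (Fin n) ℝ (TangentSpace 𝓘(ℝ, E) x₀)) (x : L) :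
    (0 : E →L[ℝ] ℝ) ∈ latticeAt b x :=
  fun _ _ _ _ => ⟨0, Int.cast_zero.symm⟩

theorem latticeAt_neg_mem {b : Module.Basis (Fin n) ℝ (TangentSpace 𝓘(ℝ, E) x₀)} {x : L}
    {p : E →L[ℝ] ℝ} (hp : p ∈ latticeAt b x) : -p ∈ latticeAt b x := by
  intro γ i w hw
  obtain ⟨k, hk⟩ := hp γ i w hw
  exact ⟨-k, (congrArg Neg.neg hk).trans (Int.cast_neg k).symm⟩

theorem latticeAt_add_mem {b : Module.Basis (Fin n) ℝ (TangentSpace 𝓘(ℝ, E) x₀)} {x : L}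
    {p p' : E →L[ℝ] ℝ} (hp : p ∈ latticeAt b x) (hp' : p' ∈ latticeAt b x) :
    p + p' ∈ latticeAt b x := by
  intro γ i w hw
  obtain ⟨k, hk⟩ := hp γ i w hw
  obtain ⟨k', hk'⟩ := hp' γ i w hw
  exact ⟨k + k', (congrArg₂ (· + ·) hk hk').trans (Int.cast_add k k').symm⟩

/-- Points of the cotangent bundle that differ by a covector of the lattice. -/
def latticeSetoid (b : Module.Basis (Fin n) ℝ (TangentSpace 𝓘(ℝ, E) x₀)) :
    Setoid (CotangentBundle E L) where
  r z w := z.proj = w.proj ∧ covector z - covector w ∈ latticeAt b z.proj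
  iseqv :=
    { refl := fun z => ⟨rfl, by rw [sub_self]; exact latticeAt_zero_mem b _⟩
      symm := fun {z w} h => ⟨h.1.symm, by
        rw [← neg_sub, ← h.1]
        exact latticeAt_neg_mem h.2⟩
      trans := fun {z w y} h h' => ⟨h.1.trans h'.1, by
        rw [← sub_add_sub_cancel _ (covector w)]
        refine latticeAt_add_mem h.2 ?_
        rw [h.1]
        exact h'.2⟩ }

/-- The torus bundle obtained from the cotangent bundle by dividing out the field of lattices. -/
def TorusBundle (b : Module.Basis (Fin n) ℝ (TangentSpace 𝓘(ℝ, E) x₀)) : Type (max u v) :=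
  Quotient (latticeSetoid b)

variable {b : Module.Basis (Fin n) ℝ (TangentSpace 𝓘(ℝ, E) x₀)}

variable (b) in
/-- The projection of the cotangent bundle to the torus bundle. -/
def toTorus : CotangentBundle E L → TorusBundle b := Quotient.mk (latticeSetoid b)

theorem toTorus_surjective : Function.Surjective (toTorus b) := Quotient.mk_surjective

theorem toTorus_eq_iff {z w : CotangentBundle E L} :
    toTorus b z = toTorus b w ↔
      z.proj = w.proj ∧ covector z - covector w ∈ latticeAt b z.proj :=
  Quotient.eq (r := latticeSetoid b)

variable (b) in
/-- The projection of the torus bundle to the base. -/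
def torusProj : TorusBundle b → L :=
  Quotient.lift (s := latticeSetoid b) TotalSpace.proj fun _ _ h => h.1

variable [HasGroupoid L (affineGroupoid E)]

instance : TopologicalSpace (TorusBundle b) :=
  inferInstanceAs (TopologicalSpace (Quotient (latticeSetoid b)))

theorem continuous_toTorus : Continuous (toTorus b) := continuous_quotient_mk'

local notation "IT" => ModelWithCorners.prod 𝓘(ℝ, E) 𝓘(ℝ, E →L[ℝ] ℝ)

/-- Locally, equality in the torus bundle is congruence of the momenta modulo a fixed lattice. -/
theorem eventually_toTorus_eq_iff (b : Module.Basis (Fin n) ℝ (TangentSpace 𝓘(ℝ, E) x₀))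
    (z : CotangentBundle E L) :
    ∀ᶠ y in 𝓝 z.proj, ∀ w w' : CotangentBundle E L, w.proj = y → w'.proj = y →
      (toTorus b w = toTorus b w' ↔
        (extChartAt IT z w).2 - (extChartAt IT z w').2 ∈ latticeAt b z.proj) := by
  filter_upwards [eventually_mem_latticeAt_iff b z.proj,
    (chartAt E z.proj).open_source.mem_nhds (mem_chart_source E z.proj)] with y hy hys w w' hw hw'
  rw [cotangent_extChartAt_apply z w (by rwa [hw]), cotangent_extChartAt_apply z w' (by rwa [hw']),
    toTorus_eq_iff]
  simp only [hw, hw', true_and]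
  rw [hy, ← ContinuousLinearMap.sub_comp, ContinuousLinearMap.comp_assoc,
    chartDerivSymm_comp hys, ContinuousLinearMap.comp_id]

/-- Equivalent points of the cotangent bundle are related by a local fibrewise translation that
does not change the class in the torus bundle. -/
theorem exists_local_translation {z₀ z₁ : CotangentBundle E L} (h : toTorus b z₀ = toTorus b z₁) :
    ∃ τ : CotangentBundle E L → CotangentBundle E L, ContinuousAt τ z₀ ∧ τ z₀ = z₁ ∧
      ∃ c : E × (E →L[ℝ] ℝ), ∀ᶠ w in 𝓝 z₀, toTorus b w = toTorus b (τ w) ∧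
        extChartAt IT z₁ (τ w) = extChartAt IT z₀ w + c := by
  obtain ⟨x, α⟩ := z₀
  obtain ⟨x', α'⟩ := z₁
  obtain ⟨h1, h2⟩ := toTorus_eq_iff.1 h
  obtain rfl : x = x' := h1
  set z₀ : CotangentBundle E L := ⟨x, α⟩
  set z₁ : CotangentBundle E L := ⟨x, α'⟩
  let l : E →L[ℝ] ℝ := covector z₁ - covector z₀
  have hl : l ∈ latticeAt b x := by
    have := latticeAt_neg_mem h2
    rwa [neg_sub] at this
  have hself : ∀ z : CotangentBundle E L,
      extChartAt IT z z = (chartAt E z.proj z.proj, covector z) := fun z => by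
    rw [cotangent_extChartAt_apply z z (mem_chart_source E _), chartDerivSymm_self]
    rfl
  have h0 : extChartAt IT z₀ z₀ + (0, l) = extChartAt IT z₁ z₁ := by
    rw [hself, hself]
    exact Prod.ext (add_zero _) (add_sub_cancel _ _)
  -- The translation adds the covector `l`, held constant in the chart and hence parallel, so it
  -- stays in the lattices of the nearby fibres.
  refine ⟨fun w => (extChartAt IT z₁).symm (extChartAt IT z₀ w + (0, l)), ?_, ?_, (0, l), ?_⟩
  · refine ContinuousAt.comp (g := (extChartAt IT z₁).symm) ?_
      ((continuousAt_extChartAt z₀).add continuousAt_const)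
    rw [h0]
    exact continuousAt_extChartAt_symm z₁
  · simp only [h0]
    exact extChartAt_to_inv z₁
  · filter_upwards [continuous_cotangent_proj.continuousAt.eventually
      (eventually_toTorus_eq_iff b z₀),
      continuous_cotangent_proj.continuousAt.eventually
      ((chartAt E x).open_source.mem_nhds (mem_chart_source E x))] with w hw hwx'
    have hwx : w.proj ∈ (chartAt E x).source := hwx'
    have ht : extChartAt IT z₀ w + (0, l) ∈ (extChartAt IT z₁).target := by
      rw [cotangent_extChartAt_target, cotangent_extChartAt_apply z₀ w hwx]
      exact ⟨by simpa using (chartAt E x).map_source hwx, trivial⟩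
    have hr := (extChartAt IT z₁).right_inv ht
    refine ⟨?_, hr⟩
    have hp : ((extChartAt IT z₁).symm (extChartAt IT z₀ w + (0, l))).proj = w.proj := by
      rw [cotangent_extChartAt_apply z₀ w hwx, Prod.mk_add_mk, add_zero,
        cotangent_extChartAt_symm_apply z₁ ((chartAt E x).map_source hwx)]
      exact (chartAt E x).left_inv hwx
    rw [hw w _ rfl hp]
    -- The charts at `z₀` and `z₁` agree definitionally, since they depend only on the common base
    -- point.
    have hr' : extChartAt IT z₀ ((extChartAt IT z₁).symm (extChartAt IT z₀ w + (0, l))) =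
      extChartAt IT z₀ w + (0, l) := hr
    rw [hr', Prod.snd_add, sub_add_cancel_left]
    exact latticeAt_neg_mem hl

/-- The saturation of an open set is open, because local translations move a neighbourhood of any
equivalent point into the set. -/
theorem isOpenMap_toTorus : IsOpenMap (toTorus b) := by
  intro U hU
  change IsOpen (toTorus b ⁻¹' (toTorus b '' U))
  rw [isOpen_iff_mem_nhds]
  rintro z ⟨w, hw, hwz⟩
  obtain ⟨τ, hτ, hτz, c, hc⟩ := exists_local_translation hwz.symm
  have := hτ.eventually (hU.mem_nhds (hτz ▸ hw))
  filter_upwards [hc, this] with y hy hyU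
  exact ⟨τ y, hyU, hy.1.symm⟩

theorem isOpenQuotientMap_toTorus : IsOpenQuotientMap (toTorus b) :=
  ⟨toTorus_surjective, continuous_toTorus, isOpenMap_toTorus⟩

/-- The projection is an open quotient map, so the relation need only be closed. Over distinct base
points this is the Hausdorff property of `L`; over the same base point it is closedness of the
lattice, which is locally constant in coordinates. -/
instance [T2Space L] [ConnectedSpace L] [hb : Fact (HasIntegralLinearHolonomy b)] :
    T2Space (TorusBundle b) := by
  rw [t2Space_iff_of_isOpenQuotientMap (isOpenQuotientMap_toTorus (b := b)), ← isOpen_compl_iff,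
    isOpen_iff_mem_nhds]
  rintro ⟨z, z'⟩ hz
  have hz : toTorus b z ≠ toTorus b z' := hz
  have hproj : Tendsto (fun p : CotangentBundle E L × CotangentBundle E L => (p.1.proj, p.2.proj))
      (𝓝 (z, z')) (𝓝 (z.proj, z'.proj)) :=
    ((continuous_cotangent_proj.comp continuous_fst).prodMk
      (continuous_cotangent_proj.comp continuous_snd)).continuousAt
  by_cases hx : z.proj = z'.proj
  · obtain ⟨B, hB⟩ := exists_latticeAt_eq hb.out z.proj
    have hcl : IsClosed (latticeAt b z.proj) := hB ▸ isClosed_integralCovectors B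
    have hmem : z' ∈ (extChartAt IT z).source := by
      rw [cotangent_extChartAt_source]
      change z'.proj ∈ (chartAt E z.proj).source
      rw [← hx]
      exact mem_chart_source E z.proj
    have hcont : ContinuousAt (fun p : CotangentBundle E L × CotangentBundle E L =>
        (extChartAt IT z p.1).2 - (extChartAt IT z p.2).2) (z, z') := by
      refine ContinuousAt.sub ?_ ?_
      · exact (ContinuousAt.comp (f := Prod.fst) (g := extChartAt IT z) (x := (z, z'))
          (continuousAt_extChartAt z) continuousAt_fst).snd
      · exact (ContinuousAt.comp (f := Prod.snd) (g := extChartAt IT z) (x := (z, z'))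
          (continuousAt_extChartAt' hmem) continuousAt_snd).snd
    have hev := eventually_toTorus_eq_iff b z
    have hnot := hcont.eventually (hcl.isOpen_compl.mem_nhds
      (fun h => hz ((hev.self_of_nhds z z' rfl hx.symm).2 h)))
    filter_upwards [hnot, (continuous_cotangent_proj.comp continuous_fst).continuousAt.eventually
      hev] with p h1 h2 h3
    exact h1 ((h2 p.1 p.2 rfl (toTorus_eq_iff.1 h3).1.symm).1 h3)
  · have : {p : L × L | p.1 ≠ p.2} ∈ 𝓝 (z.proj, z'.proj) :=
      isClosed_diagonal.isOpen_compl.mem_nhds hx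
    filter_upwards [hproj this] with p hp h
    exact hp (toTorus_eq_iff.1 h).1

/-- Over a small compact set the bundle is covered by the image of that set times a compact set of
momenta that meets every class; finitely many such sets cover `L`. -/
instance [FiniteDimensional ℝ E] [CompactSpace L] [ConnectedSpace L]
    [hb : Fact (HasIntegralLinearHolonomy b)] : CompactSpace (TorusBundle b) := by
  have hloc : ∀ x : L, ∃ K ∈ 𝓝 x, ∃ S : Set (TorusBundle b), IsCompact S ∧
      torusProj b ⁻¹' K ⊆ S := by
    intro x
    have : LocallyCompactSpace L := ChartedSpace.locallyCompactSpace E L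
    let z := ofCovector (E := E) x 0
    obtain ⟨B, hB⟩ := exists_latticeAt_eq hb.out x
    obtain ⟨C, hC, hC'⟩ := exists_isCompact_add_integralCovectors B
    obtain ⟨K, hKx, hKU, hK⟩ := local_compact_nhds (inter_mem (eventually_toTorus_eq_iff b z)
      ((chartAt E x).open_source.mem_nhds (mem_chart_source E x)))
    have hsub : (chartAt E x '' K) ×ˢ C ⊆ (extChartAt IT z).target := by
      rw [cotangent_extChartAt_target]
      rintro ⟨u, p⟩ ⟨⟨y, hy, rfl⟩, -⟩
      exact ⟨(chartAt E x).map_source (hKU hy).2, trivial⟩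
    refine ⟨K, hKx, toTorus b '' ((extChartAt IT z).symm '' ((chartAt E x '' K) ×ˢ C)), ?_, ?_⟩
    · refine IsCompact.image (IsCompact.image_of_continuousOn ?_
        ((continuousOn_extChartAt_symm z).mono hsub)) continuous_toTorus
      exact (hK.image_of_continuousOn ((chartAt E x).continuousOn.mono
        fun y hy => (hKU hy).2)).prod hC
    · intro m hm
      obtain ⟨w, rfl⟩ := toTorus_surjective m
      have hwK : w.proj ∈ K := hm
      obtain ⟨c, hc, hcp⟩ := hC' (extChartAt IT z w).2
      have hws : w.proj ∈ (chartAt E x).source := (hKU hwK).2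
      have ht : (chartAt E x w.proj, c) ∈ (extChartAt IT z).target :=
        hsub ⟨mem_image_of_mem _ hwK, hc⟩
      -- The representative of the class of `w` with the same base point and with momentum `c` in
      -- the compact set.
      refine ⟨_, mem_image_of_mem _ (mk_mem_prod (mem_image_of_mem _ hwK) hc), ?_⟩
      symm
      rw [(hKU hwK).1 w _ rfl, (extChartAt IT z).right_inv ht]
      · change _ ∈ latticeAt b x
        rw [hB]
        exact hcp
      · rw [cotangent_extChartAt_symm_apply z ((chartAt E x).map_source hws)]
        exact (chartAt E x).left_inv hws
  choose K hK S hS hKS using hloc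
  obtain ⟨t, ht⟩ := CompactSpace.elim_nhds_subcover K hK
  have huniv : (univ : Set (TorusBundle b)) = ⋃ x ∈ t, S x := by
    refine (eq_univ_of_forall fun m => ?_).symm
    obtain ⟨x, hx, hm⟩ := mem_iUnion₂.1 (ht.ge (mem_univ (torusProj b m)))
    exact mem_iUnion₂.2 ⟨x, hx, hKS x hm⟩
  exact ⟨huniv ▸ t.isCompact_biUnion fun x _ => hS x⟩

/-- Equivalent points close to `z` have momenta that differ by a small element of a fixed discrete
lattice, hence by zero. -/
theorem exists_nhds_injOn_toTorus [ConnectedSpace L] (hb : HasIntegralLinearHolonomy b)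
    (z : CotangentBundle E L) : ∃ U ∈ 𝓝 z, InjOn (toTorus b) U := by
  obtain ⟨B, hB⟩ := exists_latticeAt_eq hb z.proj
  have hcont : ContinuousAt (fun p : CotangentBundle E L × CotangentBundle E L =>
      (extChartAt IT z p.1).2 - (extChartAt IT z p.2).2) (z, z) := by
    refine ContinuousAt.sub ?_ ?_
    · exact (ContinuousAt.comp (f := Prod.fst) (g := extChartAt IT z) (x := (z, z))
        (continuousAt_extChartAt z) continuousAt_fst).snd
    · exact (ContinuousAt.comp (f := Prod.snd) (g := extChartAt IT z) (x := (z, z))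
        (continuousAt_extChartAt z) continuousAt_snd).snd
  have h0 := eventually_integralCovectors_eq_zero B
  have h1 : ∀ᶠ p : CotangentBundle E L × CotangentBundle E L in 𝓝 (z, z),
      (extChartAt IT z p.1).2 - (extChartAt IT z p.2).2 ∈ integralCovectors B →
        (extChartAt IT z p.1).2 - (extChartAt IT z p.2).2 = 0 := by
    have ht := hcont.tendsto
    simp only [sub_self] at ht
    exact ht.eventually h0
  rw [nhds_prod_eq] at h1
  obtain ⟨U, hU, hUU⟩ := eventually_prod_self_iff'.1 h1
  refine ⟨U ∩ ((extChartAt IT z).source ∩ _), inter_mem hU (inter_mem (extChartAt_source_mem_nhds z)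
    (continuous_cotangent_proj.continuousAt.eventually (eventually_toTorus_eq_iff b z))), ?_⟩
  rintro w ⟨hwU, hws, hw⟩ w' ⟨hwU', hws', -⟩ hww'
  have hproj := (toTorus_eq_iff.1 hww').1
  have h2 := (hw w w' rfl hproj.symm).1 hww'
  rw [hB] at h2
  have h3 := hUU w hwU w' hwU' h2
  refine (extChartAt IT z).injOn hws hws' (Prod.ext ?_ (sub_eq_zero.1 h3))
  rw [cotangent_extChartAt_source] at hws hws'
  rw [cotangent_extChartAt_apply z w hws, cotangent_extChartAt_apply z w' hws']
  exact congrArg (chartAt E z.proj) hproj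

theorem isLocalHomeomorph_toTorus [ConnectedSpace L] (hb : HasIntegralLinearHolonomy b) :
    IsLocalHomeomorph (toTorus b) := by
  refine IsLocalHomeomorph.mk _ fun z => ?_
  obtain ⟨U, hU, hinj⟩ := exists_nhds_injOn_toTorus hb z
  have : Nonempty (CotangentBundle E L) := ⟨z⟩
  refine ⟨OpenPartialHomeomorph.ofContinuousOpen
    ((hinj.mono interior_subset).toPartialEquiv (toTorus b) (interior U))
    continuous_toTorus.continuousOn isOpenMap_toTorus isOpen_interior,
    mem_interior_iff_mem_nhds.2 hU, fun _ _ => rfl⟩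

end Quotient

/-! ### Maps that are affine in preferred charts -/

section AffineMaps

variable {F F' : Type*} [NormedAddCommGroup F] [NormedSpace ℝ F] [NormedAddCommGroup F']
  [NormedSpace ℝ F'] {H H' : Type*} [TopologicalSpace H] [TopologicalSpace H']
  {I : ModelWithCorners ℝ F H} {I' : ModelWithCorners ℝ F' H'} [I.Boundaryless]
  {N N' : Type*} [TopologicalSpace N] [ChartedSpace H N] [TopologicalSpace N'] [ChartedSpace H' N']

theorem writtenInExtChartAt_eventuallyEq {f : N → N'} {x : N} {g : F → F'}
    (h : ∀ᶠ y in 𝓝 x, extChartAt I' (f x) (f y) = g (extChartAt I x y)) :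
    writtenInExtChartAt I I' x f =ᶠ[𝓝 (extChartAt I x x)] g := by
  have ht : Tendsto (extChartAt I x).symm (𝓝 (extChartAt I x x)) (𝓝 x) := by
    have := (continuousAt_extChartAt_symm (I := I) x).tendsto
    rwa [extChartAt_to_inv] at this
  filter_upwards [ht.eventually h, extChartAt_target_mem_nhds (I := I) x] with u hu hu'
  rw [writtenInExtChartAt, Function.comp_apply, Function.comp_apply, hu,
    (extChartAt I x).right_inv hu']

/-- A map that is affine in the preferred charts has the linear part as its derivative. -/
theorem hasMFDerivAt_of_eventually_affine {f : N → N'} {x : N} (hf : ContinuousAt f x)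
    {T : F →L[ℝ] F'} {c : F'}
    (h : ∀ᶠ y in 𝓝 x, extChartAt I' (f x) (f y) = T (extChartAt I x y) + c) :
    HasMFDerivAt I I' f x T := by
  refine ⟨hf, HasFDerivAt.hasFDerivWithinAt ?_⟩
  have := writtenInExtChartAt_eventuallyEq (g := fun u => T u + c) h
  exact (T.hasFDerivAt.add_const c).congr_of_eventuallyEq this

theorem contMDiffAt_of_eventually_affine {f : N → N'} {x : N} (hf : ContinuousAt f x)
    {T : F →L[ℝ] F'} {c : F'}
    (h : ∀ᶠ y in 𝓝 x, extChartAt I' (f x) (f y) = T (extChartAt I x y) + c) :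
    ContMDiffAt I I' ∞ f x := by
  rw [contMDiffAt_iff]
  refine ⟨hf, ContDiffAt.contDiffWithinAt ?_⟩
  have := writtenInExtChartAt_eventuallyEq (g := fun u => T u + c) h
  exact (T.contDiff.add contDiff_const).contDiffAt.congr_of_eventuallyEq this

end AffineMaps

/-! ### Linear symplectic algebra of positions and momenta -/

section Canonical

variable {E : Type*} [NormedAddCommGroup E] [NormedSpace ℝ E]

variable (E) in
/-- The canonical symplectic form `∑ dxᵢ ∧ dpᵢ`. -/
def canonicalForm : (E × (E →L[ℝ] ℝ)) [⋀^Fin 2]→L[ℝ] ℝ where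
  toFun v := (v 1).2 (v 0).1 - (v 0).2 (v 1).1
  map_update_add' v i x y := by
    fin_cases i <;> simp <;> ring
  map_update_smul' v i c x := by
    fin_cases i <;> simp <;> ring
  map_eq_zero_of_eq' v i j h hij := by
    have : v 0 = v 1 := by
      fin_cases i <;> fin_cases j <;> simp_all
    rw [this, sub_self]
  cont := by fun_prop

theorem canonicalForm_apply (v w : E × (E →L[ℝ] ℝ)) :
    canonicalForm E ![v, w] = w.2 v.1 - v.2 w.1 := rfl

theorem canonicalForm_cotangentLift (a : E ≃L[ℝ] E) (v w : E × (E →L[ℝ] ℝ)) :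
    canonicalForm E ![cotangentLift a v, cotangentLift a w] = canonicalForm E ![v, w] := by
  simp [canonicalForm_apply, cotangentLift_apply]

theorem cotangentLift_symm (a : E ≃L[ℝ] E) : (cotangentLift a).symm = cotangentLift a.symm := by
  refine ContinuousLinearEquiv.ext (funext fun v => ?_)
  rw [ContinuousLinearEquiv.symm_apply_eq, cotangentLift_apply, cotangentLift_apply]
  refine Prod.ext (a.apply_symm_apply _).symm ?_
  ext w
  simp

variable (E) in
/-- The subspace `dp = 0`. -/
def horizontalSpace : Submodule ℝ (E × (E →L[ℝ] ℝ)) :=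
  LinearMap.ker (LinearMap.snd ℝ E (E →L[ℝ] ℝ))

theorem cotangentLift_snd_eq_zero (a : E ≃L[ℝ] E) (v : E × (E →L[ℝ] ℝ)) :
    (cotangentLift a v).2 = 0 ↔ v.2 = 0 := by
  rw [cotangentLift_apply]
  constructor
  · intro h
    ext w
    simpa using DFunLike.congr_fun h (a w)
  · intro h
    simp only [h, ContinuousLinearMap.zero_comp]

theorem finrank_horizontalSpace : Module.finrank ℝ (horizontalSpace E) = Module.finrank ℝ E := by
  have h : horizontalSpace E = LinearMap.range (LinearMap.inl ℝ E (E →L[ℝ] ℝ)) := by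
    rw [LinearMap.range_inl]
    rfl
  rw [h]
  exact LinearMap.finrank_range_of_inj LinearMap.inl_injective

end Canonical

/-! ### Manifolds glued by cotangent lifts and translations -/

section CotangentAtlas

variable {E : Type*} [NormedAddCommGroup E] [NormedSpace ℝ E] {H : Type*} [TopologicalSpace H]

/-- The coordinate changes of `N` are locally the compositions of cotangent lifts of linear maps
and translations. -/
def HasCotangentAtlas (I : ModelWithCorners ℝ (E × (E →L[ℝ] ℝ)) H) (N : Type*)
    [TopologicalSpace N] [ChartedSpace H N] : Prop :=
  ∀ m m₀ : N, m₀ ∈ (extChartAt I m).source → ∃ (a : E ≃L[ℝ] E) (c : E × (E →L[ℝ] ℝ)),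
    ∀ᶠ m' in 𝓝 m₀, extChartAt I m m' = cotangentLift a (extChartAt I m₀ m') + c

variable {I : ModelWithCorners ℝ (E × (E →L[ℝ] ℝ)) H} [I.Boundaryless] {N : Type*}
  [TopologicalSpace N] [ChartedSpace H N]

theorem HasCotangentAtlas.hasMFDerivAt_extChartAt (h : HasCotangentAtlas I N) {m m₀ : N}
    (hm : m₀ ∈ (extChartAt I m).source) :
    ∃ a : E ≃L[ℝ] E, HasMFDerivAt I 𝓘(ℝ, E × (E →L[ℝ] ℝ)) (extChartAt I m) m₀
      (cotangentLift a : (E × (E →L[ℝ] ℝ)) →L[ℝ] (E × (E →L[ℝ] ℝ))) := by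
  obtain ⟨a, c, hc⟩ := h m m₀ hm
  refine ⟨a, hasMFDerivAt_of_eventually_affine (c := c) (continuousAt_extChartAt' hm) ?_⟩
  filter_upwards [hc] with m' hm'
  exact hm'

theorem HasCotangentAtlas.eventually_extChartAt_symm (h : HasCotangentAtlas I N) {m : N}
    {y : E × (E →L[ℝ] ℝ)} (hy : y ∈ (extChartAt I m).target) :
    ∃ (a : E ≃L[ℝ] E) (c : E × (E →L[ℝ] ℝ)), ∀ᶠ u in 𝓝 y,
      extChartAt I ((extChartAt I m).symm y) ((extChartAt I m).symm u) =
        cotangentLift a u + c := by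
  obtain ⟨a, c, hc⟩ := h m _ ((extChartAt I m).map_target hy)
  refine ⟨a.symm, -cotangentLift a.symm c, ?_⟩
  filter_upwards [(continuousAt_extChartAt_symm'' hy).eventually hc,
    (isOpen_extChartAt_target m).mem_nhds hy] with u hu hut
  rw [(extChartAt I m).right_inv hut] at hu
  rw [← sub_eq_add_neg, ← map_sub, ← cotangentLift_symm, ContinuousLinearEquiv.eq_symm_apply]
  exact eq_sub_of_add_eq hu.symm

theorem HasCotangentAtlas.hasMFDerivAt_extChartAt_symm (h : HasCotangentAtlas I N) {m : N}
    {y : E × (E →L[ℝ] ℝ)} (hy : y ∈ (extChartAt I m).target) :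
    ∃ a : E ≃L[ℝ] E, HasMFDerivAt 𝓘(ℝ, E × (E →L[ℝ] ℝ)) I (extChartAt I m).symm y
      (cotangentLift a : (E × (E →L[ℝ] ℝ)) →L[ℝ] (E × (E →L[ℝ] ℝ))) := by
  obtain ⟨a, c, hc⟩ := h.eventually_extChartAt_symm hy
  refine ⟨a, hasMFDerivAt_of_eventually_affine (c := c) (continuousAt_extChartAt_symm'' hy) ?_⟩
  filter_upwards [hc] with u hu
  exact hu

/-- The canonical form on a manifold with a cotangent atlas. -/
def canonicalTwoForm (I : ModelWithCorners ℝ (E × (E →L[ℝ] ℝ)) H) (N : Type*)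
    [TopologicalSpace N] [ChartedSpace H N] : TwoForm I N := fun _ => canonicalForm E

/-- The derivative of the inverse chart is a cotangent lift, and these are symplectic: the form has
constant coefficients in every preferred chart. -/
theorem HasCotangentAtlas.inChart_canonicalTwoForm (h : HasCotangentAtlas I N) {m : N}
    {y : E × (E →L[ℝ] ℝ)} (hy : y ∈ (extChartAt I m).target) :
    (canonicalTwoForm I N).inChart I m y = canonicalForm E := by
  obtain ⟨a, ha⟩ := h.hasMFDerivAt_extChartAt_symm hy
  rw [TwoForm.inChart, ha.mfderiv]
  ext v
  have : v = ![v 0, v 1] := by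
    funext i
    fin_cases i <;> rfl
  rw [this]
  exact canonicalForm_cotangentLift a (v 0) (v 1)

/-- The horizontal distribution on a manifold with a cotangent atlas. -/
def horizontalDistribution (E : Type*) [NormedAddCommGroup E] [NormedSpace ℝ E] (N : Type*)
    [TopologicalSpace N] [ChartedSpace (E × (E →L[ℝ] ℝ)) N] :
    Distribution (E × (E →L[ℝ] ℝ)) N :=
  fun _ => horizontalSpace E

end CotangentAtlas

/-! ### Symplectic form and lagrangian foliation from a cotangent atlas -/

section CotangentAtlasGeometry

variable {E : Type*} [NormedAddCommGroup E] [NormedSpace ℝ E] {N : Type*} [TopologicalSpace N]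
  [ChartedSpace (E × (E →L[ℝ] ℝ)) N]

/-- A cotangent atlas constrains preferred charts only, so `hat` is needed to reach the whole atlas.
-/
theorem HasCotangentAtlas.isManifold (h : HasCotangentAtlas 𝓘(ℝ, E × (E →L[ℝ] ℝ)) N)
    (hat : ∀ e ∈ atlas (E × (E →L[ℝ] ℝ)) N, ∃ m : N, e = chartAt _ m) :
    IsManifold 𝓘(ℝ, E × (E →L[ℝ] ℝ)) ∞ N := by
  refine isManifold_of_contDiffOn _ _ _ fun e e' he he' u hu => ?_
  obtain ⟨m, rfl⟩ := hat e he
  obtain ⟨m', rfl⟩ := hat e' he'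
  obtain ⟨⟨hut, hus⟩, -⟩ := hu
  have hut' : u ∈ (extChartAt 𝓘(ℝ, E × (E →L[ℝ] ℝ)) m).target := by
    rw [extChartAt_target]
    exact ⟨hut, mem_range_self u⟩
  obtain ⟨a, c, hc⟩ := h.eventually_extChartAt_symm hut'
  obtain ⟨a', c', hc'⟩ := h m' ((extChartAt 𝓘(ℝ, E × (E →L[ℝ] ℝ)) m).symm u)
    (by rw [extChartAt_source]; exact hus)
  refine ContDiffAt.contDiffWithinAt ?_
  have hsm : ContDiffAt ℝ ∞ (fun u => cotangentLift a' (cotangentLift a u + c) + c') u :=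
    (((cotangentLift a').contDiff.comp ((cotangentLift a).contDiff.add contDiff_const)).add
      contDiff_const).contDiffAt
  refine hsm.congr_of_eventuallyEq ?_
  filter_upwards [hc, (continuousAt_extChartAt_symm'' hut').eventually hc'] with y h1 h2
  rw [← h1, ← h2]
  rfl

theorem HasCotangentAtlas.isSymplectic (h : HasCotangentAtlas 𝓘(ℝ, E × (E →L[ℝ] ℝ)) N) :
    IsSymplectic (canonicalTwoForm 𝓘(ℝ, E × (E →L[ℝ] ℝ)) N) where
  smooth m := contDiffOn_const.congr fun _ hy => h.inChart_canonicalTwoForm hy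
  closed m y hy := by
    have : (canonicalTwoForm 𝓘(ℝ, E × (E →L[ℝ] ℝ)) N).inChart 𝓘(ℝ, E × (E →L[ℝ] ℝ)) m
        =ᶠ[𝓝 y] fun _ => canonicalForm E := by
      filter_upwards [(isOpen_extChartAt_target m).mem_nhds hy] with u hu
      exact h.inChart_canonicalTwoForm hu
    rw [this.extDeriv_eq]
    ext v
    rw [extDeriv_apply (differentiableAt_const _)]
    simp
  nondegenerate m v hv := by
    have hv' : ∀ w : E × (E →L[ℝ] ℝ), w.2 v.1 - v.2 w.1 = 0 := hv
    have h1 : v.1 = 0 := by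
      refine SeparatingDual.eq_zero_of_forall_dual_eq_zero (R := ℝ) fun p => ?_
      simpa using hv' (0, p)
    have h2 : v.2 = 0 := by
      ext x
      simpa using hv' (x, 0)
    exact Prod.ext h1 h2

theorem isLagrangian_horizontalDistribution :
    IsLagrangian (canonicalTwoForm 𝓘(ℝ, E × (E →L[ℝ] ℝ)) N) (horizontalDistribution E N) := by
  intro m v
  constructor
  · intro (hv : v.2 = 0) w (hw : w.2 = 0)
    change w.2 v.1 - v.2 w.1 = 0
    rw [hv, hw]
    simp
  · intro hv
    change v.2 = 0
    ext x
    -- Pairing with the horizontal vector `(x, 0)` reads off the momentum component of `v`.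
    have : (0 : E →L[ℝ] ℝ) v.1 - v.2 x = 0 := hv ((x, 0) : E × (E →L[ℝ] ℝ)) rfl
    simpa using this

theorem HasCotangentAtlas.isFoliation [IsManifold 𝓘(ℝ, E × (E →L[ℝ] ℝ)) ∞ N]
    (h : HasCotangentAtlas 𝓘(ℝ, E × (E →L[ℝ] ℝ)) N) :
    IsFoliation (Module.finrank ℝ E) (horizontalDistribution E N) := by
  intro m₀
  refine ⟨chartAt _ m₀, IsManifold.chart_mem_maximalAtlas m₀, mem_chart_source _ m₀,
    horizontalSpace E, finrank_horizontalSpace, fun m hm v => ?_⟩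
  obtain ⟨a, ha⟩ := h.hasMFDerivAt_extChartAt (m := m₀) (m₀ := m) (by rwa [extChartAt_source])
  have hd : mvfderiv 𝓘(ℝ, E × (E →L[ℝ] ℝ)) (chartAt (E × (E →L[ℝ] ℝ)) m₀) m v =
      cotangentLift a v := DFunLike.congr_fun ha.mfderiv v
  rw [hd]
  exact (cotangentLift_snd_eq_zero a v).symm

end CotangentAtlasGeometry

/-! ### Smooth structure of the torus bundle -/

section Torus

variable {E : Type v} [NormedAddCommGroup E] [NormedSpace ℝ E]
  {L : Type u} [TopologicalSpace L] [ChartedSpace E L] [HasGroupoid L (affineGroupoid E)]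

local notation "IT" => ModelWithCorners.prod 𝓘(ℝ, E) 𝓘(ℝ, E →L[ℝ] ℝ)

local notation "IM" => 𝓘(ℝ, E × (E →L[ℝ] ℝ))

theorem hasCotangentAtlas_cotangentBundle : HasCotangentAtlas IT (CotangentBundle E L) :=
  fun _ _ h => eventually_cotangent_extChartAt_eq h

variable [ConnectedSpace L] {n : ℕ} {x₀ : L} {b : Module.Basis (Fin n) ℝ (TangentSpace 𝓘(ℝ, E) x₀)}
  [hb : Fact (HasIntegralLinearHolonomy b)]

instance : ChartedSpace (E × (E →L[ℝ] ℝ)) (TorusBundle b) :=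
  IsLocalHomeomorph.chartedSpace (H := ModelProd E (E →L[ℝ] ℝ))
    (isLocalHomeomorph_toTorus hb.out) toTorus_surjective

/-- Exposes the choices behind the chart: a preimage `z` of `m` and a local section `e` of the
projection. Later arguments use only these properties. -/
theorem exists_torus_extChartAt_eq (m : TorusBundle b) : ∃ (z : CotangentBundle E L)
    (e : OpenPartialHomeomorph (TorusBundle b) (CotangentBundle E L)), toTorus b z = m ∧
      z ∈ e.target ∧ e.symm = toTorus b ∧ (∀ m', extChartAt IM m m' = extChartAt IT z (e m')) ∧
      (extChartAt IM m).source = e.source ∩ e ⁻¹' (extChartAt IT z).source := by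
  have hf := isLocalHomeomorph_toTorus hb.out
  have hs := (toTorus_surjective (b := b)).hasRightInverse
  refine ⟨hs.choose m, hf.localInverseAt (hs.choose m), hs.choose_spec m,
    hf.self_mem_localInverseAt_target, hf.localInverseAt_symm _, fun m' => rfl, ?_⟩
  rw [extChartAt_source, extChartAt_source]
  rfl

/-- In natural coordinates, the projection to the torus bundle is locally a translation. -/
theorem eventually_extChartAt_toTorus (z : CotangentBundle E L) :
    ∃ c : E × (E →L[ℝ] ℝ), ∀ᶠ w in 𝓝 z,
      extChartAt IM (toTorus b z) (toTorus b w) = extChartAt IT z w + c := by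
  obtain ⟨z₀, e, hz₀, hze, he, hext, -⟩ := exists_torus_extChartAt_eq (toTorus b z)
  obtain ⟨τ, hτ, hτz, c, hc⟩ := exists_local_translation hz₀.symm
  refine ⟨c, ?_⟩
  filter_upwards [hc, hτ.eventually (e.open_target.mem_nhds (hτz ▸ hze))] with w hw hwe
  rw [hext, hw.1, ← he, e.right_inv hwe, hw.2]

/-- Lifting by the local section `e` reduces a coordinate change to one on the cotangent bundle, up
to the translation by which the projection differs from the identity. -/
theorem hasCotangentAtlas_torusBundle : HasCotangentAtlas IM (TorusBundle b) := by
  intro m m₀ hm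
  obtain ⟨z, e, hz, hze, he, hext, hsrc⟩ := exists_torus_extChartAt_eq m
  rw [hsrc] at hm
  obtain ⟨a, c, hc⟩ := eventually_cotangent_extChartAt_eq hm.2
  have hq : toTorus b (e m₀) = m₀ := by rw [← he, e.left_inv hm.1]
  obtain ⟨c', hc'⟩ := eventually_extChartAt_toTorus (b := b) (e m₀)
  rw [hq] at hc'
  refine ⟨a, c - cotangentLift a c', ?_⟩
  have hcont := e.continuousAt hm.1
  filter_upwards [hcont.eventually hc, hcont.eventually hc', e.open_source.mem_nhds hm.1]
    with m' h1 h2 h3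
  have hq' : toTorus b (e m') = m' := by rw [← he, e.left_inv h3]
  rw [hq'] at h2
  rw [hext, h1, h2, map_add]
  abel

instance : IsManifold IM ∞ (TorusBundle b) := by
  refine hasCotangentAtlas_torusBundle.isManifold ?_
  rintro e ⟨m, rfl⟩
  exact ⟨m, rfl⟩

theorem hasMFDerivAt_toTorus (z : CotangentBundle E L) :
    HasMFDerivAt IT IM (toTorus b) z (ContinuousLinearMap.id ℝ (E × (E →L[ℝ] ℝ))) := by
  obtain ⟨c, hc⟩ := eventually_extChartAt_toTorus (b := b) z
  exact hasMFDerivAt_of_eventually_affine continuous_toTorus.continuousAt (c := c) hc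

theorem contMDiff_toTorus : ContMDiff IT IM ∞ (toTorus b) := fun z => by
  obtain ⟨c, hc⟩ := eventually_extChartAt_toTorus (b := b) z
  exact contMDiffAt_of_eventually_affine continuous_toTorus.continuousAt
    (T := ContinuousLinearMap.id ℝ (E × (E →L[ℝ] ℝ))) (c := c) hc

theorem isLocalDiffeomorph_toTorus : IsLocalDiffeomorph IT IM ∞ (toTorus b) := by
  intro z
  obtain ⟨e, hze, he⟩ := isLocalHomeomorph_toTorus hb.out z
  refine ⟨⟨e.toPartialEquiv, e.open_source, e.open_target, ?_, ?_⟩, hze, fun w _ => by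
    rw [he]; rfl⟩
  · change ContMDiffOn IT IM ∞ e e.source
    rw [← he]
    exact contMDiff_toTorus.contMDiffOn
  · intro m hm
    have hm : m ∈ e.target := hm
    refine ContMDiffAt.contMDiffWithinAt ?_
    change ContMDiffAt IM IT ∞ e.symm m
    obtain ⟨c, hc⟩ := eventually_extChartAt_toTorus (b := b) (e.symm m)
    have hq : ∀ m' ∈ e.target, toTorus b (e.symm m') = m' := fun m' h => by
      rw [he]
      exact e.right_inv h
    rw [hq m hm] at hc
    have hcont := e.symm.continuousAt (x := m) hm
    refine contMDiffAt_of_eventually_affine hcont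
      (T := ContinuousLinearMap.id ℝ (E × (E →L[ℝ] ℝ))) (c := -c) ?_
    filter_upwards [hcont.eventually hc, e.open_target.mem_nhds hm] with m' h1 h2
    rw [hq m' h2] at h1
    rw [h1]
    exact (add_neg_cancel_right _ _).symm

theorem isCotangentQuotient_toTorus :
    IsCotangentQuotient (cotangentLattice b) (canonicalTwoForm IM (TorusBundle b))
      (horizontalDistribution E (TorusBundle b)) (toTorus b) where
  localDiffeomorph := isLocalDiffeomorph_toTorus
  surjective := toTorus_surjective
  proj_eq z z' h := (toTorus_eq_iff.1 h).1
  eq_iff x α β := by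
    rw [toTorus_eq_iff]
    exact ⟨fun h => h.2, fun h => ⟨rfl, h⟩⟩
  form z y hy v w := by
    -- The projection has identity derivative in preferred charts, so the constant forms correspond.
    have h : (canonicalTwoForm IM (TorusBundle b)).pullback IM IT (toTorus b) =
        canonicalTwoForm IT (CotangentBundle E L) := by
      funext z
      rw [TwoForm.pullback, (hasMFDerivAt_toTorus z).mfderiv]
      rfl
    rw [h, hasCotangentAtlas_cotangentBundle.inChart_canonicalTwoForm hy]
    exact canonicalForm_apply v w
  horizontal z z' hz' v := by
    obtain ⟨a, ha⟩ := hasCotangentAtlas_cotangentBundle.hasMFDerivAt_extChartAt hz'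
    have hd : mvfderiv IT (extChartAt IT z) z' v = cotangentLift a v :=
      DFunLike.congr_fun ha.mfderiv v
    rw [hd, (hasMFDerivAt_toTorus z').mfderiv]
    exact (cotangentLift_snd_eq_zero a v).symm

end Torus

/-! ### Derivatives of functions given in a chart -/

section CoordinateExpressions

variable {F V : Type*} [NormedAddCommGroup F] [NormedSpace ℝ F] [NormedAddCommGroup V]
  [NormedSpace ℝ V] {H : Type*} [TopologicalSpace H] {I : ModelWithCorners ℝ F H} [I.Boundaryless]
  {N : Type*} [TopologicalSpace N] [ChartedSpace H N]

theorem hasMFDerivAt_of_eventuallyEq_comp_extChartAt {f : N → V} {x : N} {g : F → V}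
    {g' : F →L[ℝ] V} (h : f =ᶠ[𝓝 x] g ∘ extChartAt I x)
    (hg : HasFDerivAt g g' (extChartAt I x x)) : HasMFDerivAt I 𝓘(ℝ, V) f x g' := by
  refine ⟨?_, HasFDerivAt.hasFDerivWithinAt ?_⟩
  · exact (hg.continuousAt.comp (continuousAt_extChartAt x)).congr h.symm
  · exact hg.congr_of_eventuallyEq (writtenInExtChartAt_eventuallyEq (I' := 𝓘(ℝ, V)) h)

end CoordinateExpressions

/-! ### The Weinstein formula in canonical coordinates -/

section Weinstein

variable {E : Type*} [NormedAddCommGroup E] [NormedSpace ℝ E] {N : Type*} [TopologicalSpace N]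
  [ChartedSpace (E × (E →L[ℝ] ℝ)) N]

local notation "IM" => 𝓘(ℝ, E × (E →L[ℝ] ℝ))

/-- The coordinate expression of a vector field in the chart at `m`. -/
def fieldInChart (m : N) (V : ∀ m : N, TangentSpace IM m) (u : E × (E →L[ℝ] ℝ)) :
    E × (E →L[ℝ] ℝ) :=
  VectorField.mpullbackWithin IM IM (extChartAt IM m).symm V (range IM) u

theorem HasCotangentAtlas.exists_fieldInChart_eq (h : HasCotangentAtlas IM N) {m : N}
    {u : E × (E →L[ℝ] ℝ)} (hu : u ∈ (extChartAt IM m).target) :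
    ∃ a : E ≃L[ℝ] E, ∀ V : ∀ m : N, TangentSpace IM m,
      fieldInChart m V u = cotangentLift a (V ((extChartAt IM m).symm u)) := by
  obtain ⟨a, ha⟩ := h.hasMFDerivAt_extChartAt_symm hu
  refine ⟨a.symm, fun V => ?_⟩
  have h1 : mfderivWithin IM IM (extChartAt IM m).symm (range IM) u =
      (cotangentLift a : (E × (E →L[ℝ] ℝ)) →L[ℝ] (E × (E →L[ℝ] ℝ))) := by
    rw [modelWithCornersSelf_coe, range_id, mfderivWithin_univ, ha.mfderiv]
  rw [fieldInChart, VectorField.mpullbackWithin_apply, h1, ← cotangentLift_symm]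
  exact DFunLike.congr_fun (ContinuousLinearMap.inverse_equiv (cotangentLift a)) _

theorem HasCotangentAtlas.canonicalForm_fieldInChart (h : HasCotangentAtlas IM N) {m : N}
    {u : E × (E →L[ℝ] ℝ)} (hu : u ∈ (extChartAt IM m).target)
    (V W : ∀ m : N, TangentSpace IM m) :
    canonicalForm E ![fieldInChart m V u, fieldInChart m W u] =
      canonicalTwoForm IM N ((extChartAt IM m).symm u)
        ![V ((extChartAt IM m).symm u), W ((extChartAt IM m).symm u)] := by
  obtain ⟨a, ha⟩ := h.exists_fieldInChart_eq hu
  rw [ha V, ha W]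
  exact canonicalForm_cotangentLift a _ _

theorem HasCotangentAtlas.fieldInChart_snd (h : HasCotangentAtlas IM N) {m : N}
    {u : E × (E →L[ℝ] ℝ)} (hu : u ∈ (extChartAt IM m).target)
    {V : ∀ m : N, TangentSpace IM m} (hV : ∀ m, V m ∈ horizontalDistribution E N m) :
    (fieldInChart m V u).2 = 0 := by
  obtain ⟨a, ha⟩ := h.exists_fieldInChart_eq hu
  rw [ha V]
  exact (cotangentLift_snd_eq_zero a _).2 (hV _)

theorem fieldInChart_extChartAt [IsManifold IM 1 N] {m m' : N}
    (hm : m' ∈ (extChartAt IM m).source) (V : ∀ m : N, TangentSpace IM m) :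
    fieldInChart m V (extChartAt IM m m') = mfderiv IM IM (extChartAt IM m) m' (V m') := by
  let A : (E × (E →L[ℝ] ℝ)) →L[ℝ] (E × (E →L[ℝ] ℝ)) :=
    mfderivWithin IM IM (extChartAt IM m).symm (range IM) (extChartAt IM m m')
  let B : (E × (E →L[ℝ] ℝ)) →L[ℝ] (E × (E →L[ℝ] ℝ)) := mfderiv IM IM (extChartAt IM m) m'
  have h1 : B.comp A = ContinuousLinearMap.id ℝ _ :=
    mfderiv_extChartAt_comp_mfderivWithin_extChartAt_symm' hm
  have h2 : A.comp B = ContinuousLinearMap.id ℝ _ :=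
    mfderivWithin_extChartAt_symm_comp_mfderiv_extChartAt' hm
  have hinv : A.inverse = B := ContinuousLinearMap.inverse_eq h2 h1
  let V' : N → E × (E →L[ℝ] ℝ) := V
  change A.inverse (V' ((extChartAt IM m).symm (extChartAt IM m m'))) = B (V' m')
  rw [hinv, (extChartAt IM m).left_inv hm]

theorem fieldInChart_self [IsManifold IM 1 N] (m : N) (V : ∀ m : N, TangentSpace IM m) :
    fieldInChart m V (extChartAt IM m m) = V m := by
  rw [fieldInChart_extChartAt (mem_extChartAt_source m), mfderiv_extChartAt_self]
  rfl

theorem differentiableAt_fieldInChart [CompleteSpace E] [IsManifold IM ∞ N] (m : N)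
    {V : ∀ m : N, TangentSpace IM m} (hV : IsSmoothField V) :
    DifferentiableAt ℝ (fieldInChart m V) (extChartAt IM m m) := by
  have h := VectorField.contMDiffWithinAt_mpullbackWithin_extChartAt_symm (m := 1) (n := ∞)
    ((hV m).of_le (by norm_cast)).contMDiffWithinAt uniqueMDiffOn_univ (mem_univ m)
    (by norm_cast)
  rw [contMDiffWithinAt_vectorSpace_iff_contDiffWithinAt] at h
  refine (h.contDiffAt ?_).differentiableAt one_ne_zero
  rw [preimage_univ, inter_univ]
  exact extChartAt_target_mem_nhds (I := IM) m

theorem mlieBracket_eq_fderiv [IsManifold IM 1 N] (m : N) (V W : ∀ m : N, TangentSpace IM m) :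
    VectorField.mlieBracket IM V W m =
      fderiv ℝ (fieldInChart m W) (extChartAt IM m m) (V m) -
        fderiv ℝ (fieldInChart m V) (extChartAt IM m m) (W m) := by
  let B : (E × (E →L[ℝ] ℝ)) →L[ℝ] (E × (E →L[ℝ] ℝ)) := mfderiv IM IM (extChartAt IM m) m
  have hB : B = ContinuousLinearMap.id ℝ _ := mfderiv_extChartAt_self
  change B.inverse (VectorField.lieBracketWithin ℝ (fieldInChart m V) (fieldInChart m W)
    (univ ∩ range IM) (extChartAt IM m m)) = _
  rw [hB, ContinuousLinearMap.inverse_id, univ_inter, modelWithCornersSelf_coe, range_id,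
    VectorField.lieBracketWithin_univ]
  change fderiv ℝ (fieldInChart m W) _ (fieldInChart m V _) -
    fderiv ℝ (fieldInChart m V) _ (fieldInChart m W _) = _
  rw [fieldInChart_self, fieldInChart_self]

/-- The right hand side of the formula for the Weinstein connection, in coordinates. -/
theorem HasCotangentAtlas.weinstein_eq [CompleteSpace E] [IsManifold IM ∞ N]
    (h : HasCotangentAtlas IM N) {X Y Z : ∀ m : N, TangentSpace IM m}
    (hX : IsSmoothField X) (hY : IsSmoothField Y) (hZ : IsSmoothField Z)
    (hXD : ∀ m, X m ∈ horizontalDistribution E N m)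
    (hYD : ∀ m, Y m ∈ horizontalDistribution E N m) (m : N) :
    mvfderiv IM (fun m => canonicalTwoForm IM N m ![Y m, Z m]) m (X m) -
        canonicalTwoForm IM N m ![Y m, VectorField.mlieBracket IM X Z m] =
      (fieldInChart m Z (extChartAt IM m m)).2
        (fderiv ℝ (fieldInChart m Y) (extChartAt IM m m) (X m)).1 := by
  set u := extChartAt IM m m with hu
  have htar := extChartAt_target_mem_nhds (I := IM) m
  have dX := (differentiableAt_fieldInChart m hX).hasFDerivAt
  have dY := (differentiableAt_fieldInChart m hY).hasFDerivAt
  have dZ := (differentiableAt_fieldInChart m hZ).hasFDerivAt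
  rw [← hu] at dX dY dZ htar
  -- `X` has no momentum component near `m`, so this half of the bracket `[X, Z]` is invisible to
  -- the form when paired with a horizontal vector.
  have eX : (fderiv ℝ (fieldInChart m X) u (Z m)).2 = 0 := by
    have h1 : HasFDerivAt (fun y => (fieldInChart m X y).2) (0 : _ →L[ℝ] (E →L[ℝ] ℝ)) u := by
      refine (hasFDerivAt_const (0 : E →L[ℝ] ℝ) u).congr_of_eventuallyEq ?_
      filter_upwards [htar] with y hy
      exact h.fieldInChart_snd hy hXD
    exact DFunLike.congr_fun (dX.snd.unique h1) (Z m)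
  have hg := dZ.snd.clm_apply dY.fst
  have hf := hasMFDerivAt_of_eventuallyEq_comp_extChartAt (I := IM)
    (f := fun m => canonicalTwoForm IM N m ![Y m, Z m]) (x := m)
    (g := fun y => (fieldInChart m Z y).2 (fieldInChart m Y y).1) (by
      filter_upwards [extChartAt_source_mem_nhds (I := IM) m] with m' hm'
      have h1 := h.canonicalForm_fieldInChart ((extChartAt IM m).map_source hm') Y Z
      rw [(extChartAt IM m).left_inv hm'] at h1
      rw [← h1, canonicalForm_apply, h.fieldInChart_snd ((extChartAt IM m).map_source hm') hYD]
      exact sub_zero _) hg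
  have hd := DFunLike.congr_fun hf.mfderiv (X m)
  -- Leibniz rule for `Z_p(Y_x)`; the second term is the one that the bracket cancels.
  have e1 : mvfderiv IM (fun m => canonicalTwoForm IM N m ![Y m, Z m]) m (X m) =
      (fieldInChart m Z u).2 (fderiv ℝ (fieldInChart m Y) u (X m)).1 +
        (fderiv ℝ (fieldInChart m Z) u (X m)).2 (fieldInChart m Y u).1 := hd
  have e2 : canonicalTwoForm IM N m ![Y m, VectorField.mlieBracket IM X Z m] =
      (fderiv ℝ (fieldInChart m Z) u (X m)).2 (fieldInChart m Y u).1 := by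
    rw [mlieBracket_eq_fderiv]
    have key : ∀ y l l' : E × (E →L[ℝ] ℝ), y.2 = 0 → l'.2 = 0 →
        canonicalForm E ![y, l - l'] = l.2 y.1 := fun y l l' hy hl' => by
      rw [canonicalForm_apply, Prod.snd_sub, hy, hl', sub_zero]
      exact sub_zero _
    rw [fieldInChart_self]
    exact key (Y m) _ _ (hYD m) eX
  rw [e1, e2, add_sub_cancel_right]

end Weinstein

/-! ### The zero section as a leaf with its flat connection -/

section Leaf

variable {E : Type v} [NormedAddCommGroup E] [NormedSpace ℝ E]
  {L : Type u} [TopologicalSpace L] [ChartedSpace E L] [HasGroupoid L (affineGroupoid E)]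

local notation "IT" => ModelWithCorners.prod 𝓘(ℝ, E) 𝓘(ℝ, E →L[ℝ] ℝ)

local notation "IM" => 𝓘(ℝ, E × (E →L[ℝ] ℝ))

/-- Every point has a neighbourhood whose points are joined to it by smooth curves. -/
theorem eventually_exists_smooth_curve (x : L) : ∃ U ∈ 𝓝 x, ∀ y ∈ U, ∀ y' ∈ U,
    ∃ γ : ℝ → L, ContMDiff 𝓘(ℝ, ℝ) 𝓘(ℝ, E) ∞ γ ∧ γ 0 = y ∧ γ 1 = y' := by
  obtain ⟨r, hr, hball⟩ := Metric.mem_nhds_iff.1 (extChartAt_target_mem_nhds (I := 𝓘(ℝ, E)) x)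
  refine ⟨(extChartAt 𝓘(ℝ, E) x).source ∩ extChartAt 𝓘(ℝ, E) x ⁻¹' Metric.ball _ r,
    inter_mem (extChartAt_source_mem_nhds x)
      ((continuousAt_extChartAt x).preimage_mem_nhds (Metric.ball_mem_nhds _ hr)), ?_⟩
  rintro y ⟨hys, hy⟩ y' ⟨hys', hy'⟩
  set u := extChartAt 𝓘(ℝ, E) x y
  set u' := extChartAt 𝓘(ℝ, E) x y'
  -- The smooth cut-off keeps the segment inside the convex ball for all real times, as
  -- `TangentJoined` asks for curves on the whole line.
  let c : ℝ → E := fun t => u + Real.smoothTransition t • (u' - u)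
  have hc : ContDiff ℝ ∞ c :=
    contDiff_const.add (Real.smoothTransition.contDiff.smul contDiff_const)
  have hcmem : ∀ t, c t ∈ (extChartAt 𝓘(ℝ, E) x).target := fun t =>
    hball ((convex_ball _ r).add_smul_sub_mem hy hy'
      ⟨Real.smoothTransition.nonneg t, Real.smoothTransition.le_one t⟩)
  refine ⟨fun t => (extChartAt 𝓘(ℝ, E) x).symm (c t), ?_, ?_, ?_⟩
  · exact (contMDiffOn_extChartAt_symm x).comp_contMDiff hc.contMDiff hcmem
  · simp only [c, Real.smoothTransition.zero, zero_smul, add_zero]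
    exact (extChartAt 𝓘(ℝ, E) x).left_inv hys
  · simp only [c, Real.smoothTransition.one, one_smul, add_sub_cancel]
    exact (extChartAt 𝓘(ℝ, E) x).left_inv hys'

theorem continuous_cotangent_zero :
    Continuous (fun x : L => (⟨x, 0⟩ : CotangentBundle E L)) :=
  (Bundle.contMDiff_zeroSection (n := ∞) (IB := 𝓘(ℝ, E)) ℝ
    (fun x : L => TangentSpace 𝓘(ℝ, E) x →L[ℝ] ℝ)).continuous

variable {n : ℕ} {x₀ : L} {b : Module.Basis (Fin n) ℝ (TangentSpace 𝓘(ℝ, E) x₀)}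

variable (b) in
/-- The zero section of the torus bundle. -/
def torusZero (x : L) : TorusBundle b := toTorus b ⟨x, 0⟩

theorem continuous_torusZero : Continuous (torusZero b) :=
  continuous_toTorus.comp continuous_cotangent_zero

variable [ConnectedSpace L] [hb : Fact (HasIntegralLinearHolonomy b)]

theorem eventually_extChartAt_torusZero (x : L) : ∃ c : E × (E →L[ℝ] ℝ), ∀ᶠ y in 𝓝 x,
    extChartAt IM (torusZero b x) (torusZero b y) =
      ContinuousLinearMap.inl ℝ E (E →L[ℝ] ℝ) (extChartAt 𝓘(ℝ, E) x y) + c := by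
  let z : L → CotangentBundle E L := fun x => ⟨x, 0⟩
  have hz : Continuous z := continuous_cotangent_zero
  obtain ⟨c, hc⟩ := eventually_extChartAt_toTorus (b := b) (z x)
  refine ⟨c, ?_⟩
  filter_upwards [hz.continuousAt.eventually hc,
    (chartAt E x).open_source.mem_nhds (mem_chart_source E x)] with y hy hys
  refine hy.trans ?_
  rw [cotangent_extChartAt_apply (z x) (z y) hys]
  congr 1

theorem hasMFDerivAt_torusZero (x : L) :
    HasMFDerivAt 𝓘(ℝ, E) IM (torusZero b) x (ContinuousLinearMap.inl ℝ E (E →L[ℝ] ℝ)) := by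
  obtain ⟨c, hc⟩ := eventually_extChartAt_torusZero (b := b) x
  exact hasMFDerivAt_of_eventually_affine continuous_torusZero.continuousAt hc

theorem mfderiv_torusZero (x : L) (v : E) :
    mfderiv 𝓘(ℝ, E) IM (torusZero b) x v = ((v, 0) : E × (E →L[ℝ] ℝ)) :=
  DFunLike.congr_fun (hasMFDerivAt_torusZero x).mfderiv v

theorem contMDiff_torusZero : ContMDiff 𝓘(ℝ, E) IM ∞ (torusZero b) := fun x => by
  obtain ⟨c, hc⟩ := eventually_extChartAt_torusZero (b := b) x
  exact contMDiffAt_of_eventually_affine continuous_torusZero.continuousAt hc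

/-- The zero section carries smooth curves of `L` to tangent curves, so the points it sends into the
leaf form a clopen subset of connected `L`. -/
theorem range_torusZero_subset_leafThrough (x : L) :
    range (torusZero b) ⊆ leafThrough (horizontalDistribution E (TorusBundle b))
      (torusZero b x) := by
  have hjoin : ∀ γ : ℝ → L, ContMDiff 𝓘(ℝ, ℝ) 𝓘(ℝ, E) ∞ γ →
      TangentJoined (horizontalDistribution E (TorusBundle b)) (torusZero b (γ 0))
        (torusZero b (γ 1)) := fun γ hγ => by
    refine ⟨torusZero b ∘ γ, contMDiff_torusZero.comp hγ, rfl, rfl, fun t => ?_⟩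
    have hd := (hasMFDerivAt_torusZero (b := b) (γ t)).comp t
      ((hγ t).mdifferentiableAt (by simp)).hasMFDerivAt
    rw [hd.mfderiv]
    rfl
  have hnear : ∀ y : L, ∀ᶠ y' in 𝓝 y,
      torusZero b y' ∈ leafThrough (horizontalDistribution E (TorusBundle b)) (torusZero b x) ↔
      torusZero b y ∈ leafThrough (horizontalDistribution E (TorusBundle b)) (torusZero b x) := by
    intro y
    obtain ⟨U, hU, hUU⟩ := eventually_exists_smooth_curve (E := E) y
    filter_upwards [hU] with y' hy'
    have key : ∀ z ∈ U, ∀ z' ∈ U,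
        torusZero b z ∈ leafThrough (horizontalDistribution E (TorusBundle b)) (torusZero b x) →
        torusZero b z' ∈ leafThrough (horizontalDistribution E (TorusBundle b))
          (torusZero b x) := by
      intro z hz z' hz' h
      obtain ⟨γ, hγ, h0, h1⟩ := hUU z hz z' hz'
      have := hjoin γ hγ
      rw [h0, h1] at this
      exact Relation.ReflTransGen.tail h this
    exact ⟨key _ hy' _ (mem_of_mem_nhds hU), key _ (mem_of_mem_nhds hU) _ hy'⟩
  have hcl : IsClopen {y : L | torusZero b y ∈
      leafThrough (horizontalDistribution E (TorusBundle b)) (torusZero b x)} := by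
    constructor
    · rw [← isOpen_compl_iff, isOpen_iff_mem_nhds]
      intro y hy
      filter_upwards [hnear y] with y' hy'
      exact fun h => hy (hy'.1 h)
    · rw [isOpen_iff_mem_nhds]
      intro y hy
      filter_upwards [hnear y] with y' hy'
      exact hy'.2 hy
  rintro _ ⟨y, rfl⟩
  exact (hcl.eq_univ ⟨x, Relation.ReflTransGen.refl⟩).ge (mem_univ y)

/-- The times spent in the zero section form a closed set, as its image is compact, and an open one,
as momenta are locally constant along the curve. -/
theorem mem_range_torusZero_of_tangentJoined [T2Space L] [CompactSpace L] {m m' : TorusBundle b}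
    (hm : m ∈ range (torusZero b))
    (h : TangentJoined (horizontalDistribution E (TorusBundle b)) m m') :
    m' ∈ range (torusZero b) := by
  obtain ⟨γ, hγ, rfl, rfl, hD⟩ := h
  have hcl : IsClopen (γ ⁻¹' range (torusZero b)) := by
    refine ⟨(isCompact_range continuous_torusZero).isClosed.preimage hγ.continuous, ?_⟩
    rw [isOpen_iff_mem_nhds]
    rintro t₀ ⟨y, hy⟩
    obtain ⟨c, hc⟩ := eventually_extChartAt_torusZero (b := b) y
    set ψ := extChartAt IM (torusZero b y) with hψ
    have hγs : ∀ᶠ t in 𝓝 t₀, γ t ∈ ψ.source := by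
      refine hγ.continuous.continuousAt.eventually ?_
      rw [← hy]
      exact extChartAt_source_mem_nhds _
    obtain ⟨r, hr, hball⟩ := Metric.eventually_nhds_iff_ball.1 hγs
    have hder : ∀ t ∈ Metric.ball t₀ r, HasFDerivAt (fun t => (ψ (γ t)).2)
        (0 : ℝ →L[ℝ] (E →L[ℝ] ℝ)) t := by
      intro t ht
      obtain ⟨a, ha⟩ := hasCotangentAtlas_torusBundle.hasMFDerivAt_extChartAt (hball t ht)
      have h1 := (ha.comp t ((hγ t).mdifferentiableAt (by simp)).hasMFDerivAt).hasFDerivAt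
      have h2 := h1.snd
      refine h2.congr_fderiv ?_
      ext1
      exact (cotangentLift_snd_eq_zero a _).2 (hD t)
    have hconst : ∀ t ∈ Metric.ball t₀ r, (ψ (γ t)).2 = (ψ (γ t₀)).2 := fun t ht =>
      Metric.isOpen_ball.is_const_of_fderiv_eq_zero (𝕜 := ℝ)
        (convex_ball t₀ r).isPreconnected
        (fun s hs => (hder s hs).differentiableAt.differentiableWithinAt)
        (fun s hs => (hder s hs).fderiv) ht (Metric.mem_ball_self hr)
    have hψ0 : ψ (γ t₀) =
        ContinuousLinearMap.inl ℝ E (E →L[ℝ] ℝ) (extChartAt 𝓘(ℝ, E) y y) + c := by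
      rw [← hy]
      exact hc.self_of_nhds
    have hψ1 : (ψ (γ t₀)).1 - c.1 = extChartAt 𝓘(ℝ, E) y y := by
      rw [hψ0]
      simp
    have hψ2 : (ψ (γ t₀)).2 = c.2 := by
      rw [hψ0]
      simp
    -- The base point read off from the position coordinates; `c` is the offset between the chart of
    -- the torus bundle and that of `L`.
    let s : ℝ → L := fun t => (extChartAt 𝓘(ℝ, E) y).symm ((ψ (γ t)).1 - c.1)
    have hcψ : ContinuousAt (fun t => (ψ (γ t)).1 - c.1) t₀ := by
      refine ContinuousAt.sub ?_ continuousAt_const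
      refine ContinuousAt.fst (ContinuousAt.comp (g := ψ) (f := γ) ?_ hγ.continuous.continuousAt)
      rw [← hy]
      exact continuousAt_extChartAt _
    have hs : Tendsto s (𝓝 t₀) (𝓝 y) := by
      have h1 : ContinuousAt (extChartAt 𝓘(ℝ, E) y).symm ((ψ (γ t₀)).1 - c.1) := by
        rw [hψ1]
        exact continuousAt_extChartAt_symm y
      have h2 := ContinuousAt.comp (f := fun t => (ψ (γ t)).1 - c.1) h1 hcψ
      have h3 : (extChartAt 𝓘(ℝ, E) y).symm ((ψ (γ t₀)).1 - c.1) = y := by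
        rw [hψ1, extChartAt_to_inv]
      have h4 := h2.tendsto
      rwa [Function.comp_apply, h3] at h4
    have htar : ∀ᶠ t in 𝓝 t₀, (ψ (γ t)).1 - c.1 ∈ (extChartAt 𝓘(ℝ, E) y).target := by
      refine hcψ.preimage_mem_nhds ?_
      simp only [hψ1]
      exact extChartAt_target_mem_nhds y
    filter_upwards [hs.eventually hc, htar, Metric.ball_mem_nhds t₀ hr,
      hs.eventually (continuous_torusZero.continuousAt.eventually
        (extChartAt_source_mem_nhds (I := IM) (torusZero b y)))] with t h1 h2 h3 h4
    refine ⟨s t, ψ.injOn h4 (hball t h3) ?_⟩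
    rw [h1, (extChartAt 𝓘(ℝ, E) y).right_inv h2]
    refine Prod.ext (by simp) ?_
    rw [hconst t h3, hψ2]
    simp
  exact (hcl.eq_univ ⟨0, hm⟩).ge (mem_univ (1 : ℝ))

theorem isLeaf_torusZero [T2Space L] [CompactSpace L] :
    IsLeaf (E := E) (horizontalDistribution E (TorusBundle b)) (torusZero b) where
  smooth := contMDiff_torusZero
  injective x y h := (toTorus_eq_iff.1 h).1
  immersion x v w h := by
    have h' := (mfderiv_torusZero (E := E) (b := b) x v).symm.trans
      (h.trans (mfderiv_torusZero (E := E) x w))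
    exact congrArg Prod.fst h'
  tangent x v := by
    constructor
    · intro hv
      refine ⟨v.1, (mfderiv_torusZero (E := E) x v.1).trans ?_⟩
      exact Prod.ext rfl (Eq.symm hv)
    · rintro ⟨ξ, rfl⟩
      exact congrArg Prod.snd (mfderiv_torusZero (E := E) (b := b) x ξ)
  range_eq x := by
    refine (range_torusZero_subset_leafThrough x).antisymm fun m hm' => ?_
    have hm : Relation.ReflTransGen (TangentJoined (horizontalDistribution E (TorusBundle b)))
      (torusZero b x) m := hm'
    clear hm'
    induction hm with
    | refl => exact mem_range_self x
    | tail _ h ih => exact mem_range_torusZero_of_tangentJoined ih h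

/-- The coordinate expression of the flat connection of the zero section. -/
theorem flatConnection_eq_fderiv_fieldInChart [CompleteSpace E]
    {Y : ∀ m : TorusBundle b, TangentSpace IM m} (hY : IsSmoothField Y)
    {η : ∀ x : L, TangentSpace 𝓘(ℝ, E) x}
    (hη : ∀ x, mfderiv 𝓘(ℝ, E) IM (torusZero b) x (η x) = Y (torusZero b x)) (x : L) (v : E) :
    flatConnection E η x v =
      (fderiv ℝ (fieldInChart (torusZero b x) Y)
        (extChartAt IM (torusZero b x) (torusZero b x)) (v, 0)).1 := by
  obtain ⟨c, hc⟩ := eventually_extChartAt_torusZero (b := b) x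
  set m := torusZero b x with hm
  set ψ := extChartAt IM m with hψ
  -- In charts the zero section is `u ↦ (u, 0) + c`, so the coordinates of `η` are the position part
  -- of those of `Y`; differentiating gives the claim by the chain rule.
  have hfield : ∀ᶠ y in 𝓝 x, mvfderiv 𝓘(ℝ, E) (extChartAt 𝓘(ℝ, E) x) y (η y) =
      (fieldInChart m Y (ContinuousLinearMap.inl ℝ E (E →L[ℝ] ℝ)
        (extChartAt 𝓘(ℝ, E) x y) + c)).1 := by
    filter_upwards [hc.eventually_nhds, (chartAt E x).open_source.mem_nhds (mem_chart_source E x),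
      continuous_torusZero.continuousAt.eventually (extChartAt_source_mem_nhds (I := IM) m)]
      with y hy hys hyψ
    have h1 := (mdifferentiableAt_extChartAt (I := IM) (x := m)
      (by rwa [extChartAt_source] at hyψ)).hasMFDerivAt.comp y (hasMFDerivAt_torusZero (b := b) y)
    obtain ⟨c', hc'⟩ := eventually_chart_eq hys
    have h2 : HasMFDerivAt 𝓘(ℝ, E) IM (ψ ∘ torusZero b) y
        ((ContinuousLinearMap.inl ℝ E (E →L[ℝ] ℝ)).comp (chartDeriv (E := E) x y)) := by
      refine hasMFDerivAt_of_eventually_affine h1.continuousAt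
        (c := ContinuousLinearMap.inl ℝ E (E →L[ℝ] ℝ) c' + c) ?_
      filter_upwards [hy, hc'] with y' h3 h4
      refine h3.trans ?_
      have h5 : extChartAt 𝓘(ℝ, E) x y' = chartDeriv x y (extChartAt 𝓘(ℝ, E) y y') + c' := h4.1
      rw [h5, map_add, add_assoc]
      rfl
    have h6 := DFunLike.congr_fun (hasMFDerivAt_unique h1 h2) (η y)
    have h7 : mfderiv IM IM ψ (torusZero b y) (Y (torusZero b y)) =
        ContinuousLinearMap.inl ℝ E (E →L[ℝ] ℝ) (chartDeriv (E := E) x y (η y)) := by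
      rw [← hη y, (hasMFDerivAt_torusZero (E := E) (b := b) y).mfderiv]
      exact h6
    rw [← hy.self_of_nhds, fieldInChart_extChartAt hyψ, h7]
    exact mvfderiv_extChartAt_eq_chartDeriv (E := E) hys (η y)
  have hu : ψ m = ContinuousLinearMap.inl ℝ E (E →L[ℝ] ℝ) (extChartAt 𝓘(ℝ, E) x x) + c :=
    hc.self_of_nhds
  have dY := (differentiableAt_fieldInChart m hY).hasFDerivAt
  rw [← hψ] at dY
  have dg : HasFDerivAt (fun u => (fieldInChart m Y
      (ContinuousLinearMap.inl ℝ E (E →L[ℝ] ℝ) u + c)).1) _ (extChartAt 𝓘(ℝ, E) x x) :=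
    (HasFDerivAt.comp (extChartAt 𝓘(ℝ, E) x x)
      (f := fun u => ContinuousLinearMap.inl ℝ E (E →L[ℝ] ℝ) u + c) (hu ▸ dY)
      ((ContinuousLinearMap.inl ℝ E (E →L[ℝ] ℝ)).hasFDerivAt.add_const c)).fst
  have dh := hasMFDerivAt_of_eventuallyEq_comp_extChartAt (I := 𝓘(ℝ, E))
    (x := x) (f := fun y => mvfderiv 𝓘(ℝ, E) (extChartAt 𝓘(ℝ, E) x) y (η y))
    (g := fun u => (fieldInChart m Y (ContinuousLinearMap.inl ℝ E (E →L[ℝ] ℝ) u + c)).1) hfield dg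
  let B : E →L[ℝ] E := mvfderiv 𝓘(ℝ, E) (extChartAt 𝓘(ℝ, E) x) x
  have hB : B = ContinuousLinearMap.id ℝ E := by
    ext1 w
    exact (mvfderiv_extChartAt_eq_chartDeriv (mem_chart_source E x) w).trans
      (DFunLike.congr_fun (chartDeriv_self x) w)
  change B.inverse _ = _
  rw [hB, ContinuousLinearMap.inverse_id, hu]
  exact DFunLike.congr_fun dh.mfderiv v

theorem isWeinsteinConnection_torusZero [CompleteSpace E] :
    IsWeinsteinConnection (E := E) (canonicalTwoForm IM (TorusBundle b))
      (horizontalDistribution E (TorusBundle b)) (torusZero b) := by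
  intro X Y Z hX hY hZ hXD hYD ξ η hξ hη x
  rw [hasCotangentAtlas_torusBundle.weinstein_eq hX hY hZ hXD hYD]
  have hX' : X (torusZero b x) = ((ξ x, 0) : E × (E →L[ℝ] ℝ)) :=
    (hξ x).symm.trans (mfderiv_torusZero (E := E) x (ξ x))
  have hflat := mfderiv_torusZero (E := E) (b := b) x (flatConnection E η x (ξ x))
  rw [hX', fieldInChart_self]
  have key : ∀ (z : E × (E →L[ℝ] ℝ)) (d d' : E) (w : E × (E →L[ℝ] ℝ)), w = (d, 0) → d = d' →
      canonicalForm E ![w, z] = z.2 d' := by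
    rintro z d _ _ rfl rfl
    exact sub_zero _
  exact key (Z (torusZero b x)) _ _ _ hflat
    (flatConnection_eq_fderiv_fieldInChart hY hη x (ξ x))

end Leaf

end LagrangianLeaf

end

theorem proposition2p4 (n : ℕ) (L : Type u) [TopologicalSpace L]
    [ChartedSpace (EuclideanSpace ℝ (Fin n)) L]
    [HasGroupoid L (affineGroupoid (EuclideanSpace ℝ (Fin n)))]
    [T2Space L] [CompactSpace L] [ConnectedSpace L]
    (x₀ : L)
    (b : Module.Basis (Fin n) ℝ (TangentSpace 𝓘(ℝ, EuclideanSpace ℝ (Fin n)) x₀))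
    (hb : HasIntegralLinearHolonomy b) :
    ∃ (M : Type u) (_ : TopologicalSpace M)
      (_ : ChartedSpace (EuclideanSpace ℝ (Fin n) × (EuclideanSpace ℝ (Fin n) →L[ℝ] ℝ)) M)
      (_ : IsManifold 𝓘(ℝ, EuclideanSpace ℝ (Fin n) × (EuclideanSpace ℝ (Fin n) →L[ℝ] ℝ)) ∞ M)
      (_ : T2Space M) (_ : CompactSpace M)
      (σ : TwoForm 𝓘(ℝ, EuclideanSpace ℝ (Fin n) × (EuclideanSpace ℝ (Fin n) →L[ℝ] ℝ)) M)
      (D : Distribution (EuclideanSpace ℝ (Fin n) × (EuclideanSpace ℝ (Fin n) →L[ℝ] ℝ)) M)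
      (q : CotangentBundle (EuclideanSpace ℝ (Fin n)) L → M),
      IsSymplectic σ ∧ IsFoliation n D ∧ IsLagrangian σ D ∧
      IsLeaf (E := EuclideanSpace ℝ (Fin n)) D (fun x : L => q ⟨x, 0⟩) ∧
      IsWeinsteinConnection (E := EuclideanSpace ℝ (Fin n)) σ D (fun x : L => q ⟨x, 0⟩) ∧
      IsCotangentQuotient (cotangentLattice b) σ D q := by
  have : Fact (HasIntegralLinearHolonomy b) := ⟨hb⟩
  refine ⟨TorusBundle b, inferInstance, inferInstance, inferInstance, inferInstance, inferInstance,
    canonicalTwoForm _ _, horizontalDistribution _ _, toTorus b,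
    hasCotangentAtlas_torusBundle.isSymplectic, ?_, isLagrangian_horizontalDistribution,
    isLeaf_torusZero, isWeinsteinConnection_torusZero, isCotangentQuotient_toTorus⟩
  have h := hasCotangentAtlas_torusBundle (b := b).isFoliation
  rwa [finrank_euclideanSpace_fin] at h
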